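/- An XOR-clause is a linear equation $x_{i_1}+\dots+x_{i_k}=\varepsilon$ over the two-element field, with $\varepsilon\in\{0,1\}$, and an XOR-CNF is a finite sequence $\varphi=(C_1,\dots,C_m)$ of XOR-clauses. A signature of $\varphi$ is a binary sequence $(C_1(\mathbf a),\dots,C_m(\mathbf a))\in\{0,1\}^m$, where $\mathbf a$ is a $0/1$-assignment of the variables and $C_i(\mathbf a)=1$ if $\mathbf a$ satisfies $C_i$, $C_i(\mathbf a)=0$ otherwise. Theorem. The set of signatures of an XOR-CNF formula can be enumerated with polynomial delay and polynomial space. That is, there are a random access machine (with addition and truncated subtraction) and two polynomials $d$ and $s$ such that, for every XOR-CNF $\varphi$, with input size $N$ (the length of $\varphi$ in bits, variable indices being written in binary), the machine on input $\varphi$ outputs each signature of $\varphi$ exactly once, outputs nothing else, and halts; the number of steps before the first output, between two consecutive outputs, and from the last output to halting is at most $d(N)$; and at every time its memory (not counting the solutions already output) takes at most $s(N)$ bits. -/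

import Mathlib

/-! ### XOR-CNF formulas and their signatures -/

/-- An XOR-clause, written as a linear equation `x₁ + ⋯ + x_k = ε` over the two-element field.
Variables are named by natural numbers. A variable listed several times is added that often. -/
structure XorClause where
  vars : List ℕ
  rhs : ZMod 2

/-- An XOR-CNF `C₁ ∧ ⋯ ∧ C_m`, given as the sequence of its clauses
(empty and repeated clauses are allowed). -/
abbrev XorCNF := List XorClause

/-- The clause evaluates to 1 under the assignment `a`. -/
def XorClause.Sat (C : XorClause) (a : ℕ → ZMod 2) : Prop :=
  (C.vars.map a).sum = C.rhs

instance (C : XorClause) (a : ℕ → ZMod 2) : Decidable (C.Sat a) :=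
  inferInstanceAs (Decidable (_ = _))

/-- The signature `(C₁(a), …, C_m(a))` produced by the assignment `a`. Only the values of `a` on
the variables that occur in `φ` matter. -/
def XorCNF.signature (φ : XorCNF) (a : ℕ → ZMod 2) : List Bool :=
  φ.map fun C => decide (C.Sat a)

/-- The set of all signatures of `φ`. -/
def XorCNF.signatures (φ : XorCNF) : Set (List Bool) :=
  Set.range φ.signature

/-- A clause as input for a machine: right-hand side, number of variables, variables. -/
def XorClause.encode (C : XorClause) : List ℕ :=
  C.rhs.val :: C.vars.length :: C.vars

/-- A formula as input for a machine: number of clauses, then the clauses one after the other. -/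
def XorCNF.encode (φ : XorCNF) : List ℕ :=
  φ.length :: φ.flatMap XorClause.encode

/-! ### Random access machines with an output device

The memory consists of cells that hold natural numbers. A cell is addressed by the name `a` of an
array (a constant of the program) and an index `i` (which may be computed). Scalar variables are
cells with a constant index. The arithmetic is addition and truncated subtraction. -/

namespace RAM

/-- Memory contents; all but finitely many cells contain 0. -/
abbrev Mem := ℕ × ℕ →₀ ℕ

/-- Expressions. -/
inductive Expr where
  /-- a constant -/
  | lit (n : ℕ)
  /-- the content of the cell of array `a` whose index is the value of `i` -/
  | cell (a : ℕ) (i : Expr)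
  | add (e f : Expr)
  | sub (e f : Expr)

/-- The value of an expression. -/
def Expr.eval (M : Mem) : Expr → ℕ
  | lit n => n
  | cell a i => M (a, i.eval M)
  | add e f => e.eval M + f.eval M
  | sub e f => e.eval M - f.eval M

/-- Programs. -/
inductive Prog where
  | skip
  /-- store the value of `e` in the cell of array `a` whose index is the value of `i` -/
  | store (a : ℕ) (i e : Expr)
  | seq (P Q : Prog)
  /-- run `P` if `e` is nonzero, and `Q` otherwise -/
  | ite (e : Expr) (P Q : Prog)
  /-- repeat `P` as long as `e` is nonzero -/
  | loop (e : Expr) (P : Prog)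
  /-- append one bit (1 if `e` is nonzero, 0 otherwise) to the solution that is being written -/
  | write (e : Expr)
  /-- the solution that is being written is complete: output it and start a new, empty one -/
  | emit

/-- Configurations: what is left to execute (for a fixed program this takes only finitely many
values), the memory, the bits of the solution being written, and the solutions output so far.
The machine cannot read `buf` and `out`. -/
structure Config where
  code : List Prog
  mem : Mem
  buf : List Bool
  out : List (List Bool)

/-- One step of computation; a configuration with nothing left to execute has halted. -/
noncomputable def step : Config → Config
  | ⟨[], M, b, o⟩ => ⟨[], M, b, o⟩
  | ⟨.skip :: k, M, b, o⟩ => ⟨k, M, b, o⟩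
  | ⟨.store a i e :: k, M, b, o⟩ => ⟨k, M.update (a, i.eval M) (e.eval M), b, o⟩
  | ⟨.seq P Q :: k, M, b, o⟩ => ⟨P :: Q :: k, M, b, o⟩
  | ⟨.ite e P Q :: k, M, b, o⟩ => ⟨(if e.eval M ≠ 0 then P else Q) :: k, M, b, o⟩
  | ⟨.loop e P :: k, M, b, o⟩ => ⟨if e.eval M ≠ 0 then P :: .loop e P :: k else k, M, b, o⟩
  | ⟨.write e :: k, M, b, o⟩ => ⟨k, M, b ++ [decide (e.eval M ≠ 0)], o⟩
  | ⟨.emit :: k, M, b, o⟩ => ⟨k, M, [], o ++ [b]⟩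

/-- The memory whose array 0 contains the word `w`, all other cells being 0. -/
noncomputable def inputMem (w : List ℕ) : Mem :=
  Finsupp.onFinset ({0} ×ˢ Finset.range w.length)
    (fun c => if c.1 = 0 then w.getD c.2 0 else 0)
    (by
      rintro ⟨a, i⟩ h
      by_cases ha : a = 0 <;> by_cases hi : i < w.length <;> simp_all)

/-- The configuration of the program `P` on input `w` after `t` steps. -/
noncomputable def run (P : Prog) (w : List ℕ) (t : ℕ) : Config :=
  step^[t] ⟨[P], inputMem w, [], []⟩

/-- The machine has halted. -/
def Config.Halted (c : Config) : Prop := c.code = []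

/-- The space in use, in bits: the total binary length of the contents and of the addresses of all
cells that are not 0. (The input counts; solutions that have been output do not.) -/
def Config.space (c : Config) : ℕ :=
  c.mem.sum fun x v => Nat.size x.1 + Nat.size x.2 + Nat.size v

/-- The size of an input, in bits (with one additional bit per number as a separator). -/
def inputSize (w : List ℕ) : ℕ := (w.map fun n => Nat.size n + 1).sum

/-- `P` enumerates the set `S` on input `w`: it halts after having output each element of `S`
exactly once and nothing else. -/
def Enumerates (P : Prog) (w : List ℕ) (S : Set (List Bool)) : Prop :=
  ∃ T, (run P w T).Halted ∧ (run P w T).out.Nodup ∧ {s | s ∈ (run P w T).out} = S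

/-- The delay of `P` on input `w` is at most `D`: from any time on, within `D` steps there is a
further output or the machine has halted. This bounds the time before the first output, between
consecutive outputs, and between the last output and halting. -/
def DelayAtMost (P : Prog) (w : List ℕ) (D : ℕ) : Prop :=
  ∀ t, (run P w t).out.length < (run P w (t + D)).out.length ∨ (run P w (t + D)).Halted

/-- The space used by `P` on input `w` is never more than `s` bits. -/
def SpaceAtMost (P : Prog) (w : List ℕ) (s : ℕ) : Prop :=
  ∀ t, (run P w t).space ≤ s

/-- An enumeration problem (instances of type `α`, presented to the machine through `enc`, with
solution sets `sols`) can be solved with polynomial delay and polynomial space: one program solves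
all the instances, with delay and space bounded by polynomials in the size of the input. Since a
memory cell holds only polynomially many bits then, counting every instruction as one step is
polynomially equivalent to counting bit operations. -/
def EnumerableWithPolyDelayPolySpace {α : Type} (enc : α → List ℕ) (sols : α → Set (List Bool)) :
    Prop :=
  ∃ (P : Prog) (d s : Polynomial ℕ), ∀ x : α,
    Enumerates P (enc x) (sols x) ∧
    DelayAtMost P (enc x) (d.eval (inputSize (enc x))) ∧
    SpaceAtMost P (enc x) (s.eval (inputSize (enc x)))

end RAM

/-!
The signature of an assignment is the signature of the zero assignment plus the image of the
assignment under the coefficient matrix, so the signatures form a coset of the column space of this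
matrix over `ZMod 2`. Gaussian elimination turns the columns into an echelon basis of `r` rows, and
the signatures correspond bijectively to the values `0, …, 2 ^ r - 1` of a binary counter with one
digit for each row. When the counter is incremented, the next signature is the current one plus the
rows whose digits change, which takes polynomial time.

In a single step the number of cells in use and the length of the longest number grow by at most a
constant. This does not bound the space over exponentially many rounds, but at the beginnings of two
rounds the memories differ only in polynomially many cells, which hold bits.
-/

namespace RAM

/-! ### Program logic -/

section ProgramLogic

/-- A configuration without its code. -/
structure State where
  mem : Mem
  buf : List Bool
  out : List (List Bool)

/-- The configuration that executes the code `k` from the state `s`. -/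
def State.config (s : State) (k : List Prog) : Config := ⟨k, s.mem, s.buf, s.out⟩

/-- The state after `v` has been stored in the cell of array `a` with index `i`. -/
noncomputable def State.set (s : State) (a i v : ℕ) : State :=
  { s with mem := s.mem.update (a, i) v }

@[simp] lemma State.set_mem (s : State) (a i v a' i' : ℕ) :
    (s.set a i v).mem (a', i') = if a' = a ∧ i' = i then v else s.mem (a', i') := by
  simp [State.set, Function.update_apply]

/-- Whether some instruction of the program may write to the cell of array `a` with index `i`;
computed indices are taken to be arbitrary. -/
def Prog.writes : Prog → ℕ → ℕ → Bool
  | store b (.lit n) _, a, i => a == b && i == n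
  | store b _ _, a, _ => a == b
  | seq P Q, a, i => P.writes a i || Q.writes a i
  | ite _ P Q, a, i => P.writes a i || Q.writes a i
  | loop _ P, a, i => P.writes a i
  | _, _, _ => false

/-- Whether the program never uses the output device. -/
def Prog.silent : Prog → Bool
  | seq P Q => P.silent && Q.silent
  | ite _ P Q => P.silent && Q.silent
  | loop _ P => P.silent
  | write _ => false
  | emit => false
  | _ => true

/-- The states `s` and `s'` agree on everything that `P` cannot change. -/
structure Frame (P : Prog) (s s' : State) : Prop where
  mem : ∀ a i, P.writes a i = false → s'.mem (a, i) = s.mem (a, i)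
  buf : P.silent = true → s'.buf = s.buf
  out : P.silent = true → s'.out = s.out

lemma Frame.refl (P : Prog) (s : State) : Frame P s s :=
  ⟨fun _ _ _ => rfl, fun _ => rfl, fun _ => rfl⟩

lemma Frame.trans {P : Prog} {s s' s'' : State} (h : Frame P s s') (h' : Frame P s' s'') :
    Frame P s s'' :=
  ⟨fun a i ha => (h'.mem a i ha).trans (h.mem a i ha),
    fun hP => (h'.buf hP).trans (h.buf hP), fun hP => (h'.out hP).trans (h.out hP)⟩

lemma Frame.weaken {P Q : Prog} {s s' : State} (h : Frame P s s')
    (hw : ∀ a i, Q.writes a i = false → P.writes a i = false)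
    (hs : Q.silent = true → P.silent = true) : Frame Q s s' :=
  ⟨fun a i ha => h.mem a i (hw a i ha), fun hQ => h.buf (hs hQ), fun hQ => h.out (hs hQ)⟩

lemma Frame.store (s : State) (a : ℕ) (i e : Expr) :
    Frame (.store a i e) s (s.set a (i.eval s.mem) (e.eval s.mem)) where
  mem b j hb := by
    rw [State.set_mem, if_neg]
    rintro ⟨rfl, rfl⟩
    cases i <;> simp [Prog.writes, Expr.eval] at hb
  buf _ := rfl
  out _ := rfl

/-- A bound for the running time of a program all of whose loops are repeated at most `X` times. -/
noncomputable def Prog.time : Prog → Polynomial ℕ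
  | seq P Q => P.time + Q.time + 1
  | ite _ P Q => P.time + Q.time + 1
  | loop _ P => .X * (P.time + 1) + 1
  | _ => 1

/-- Weakest precondition: from the state `s` the program `P` terminates within the time allotted
by `Prog.time` for loops of at most `N` rounds, in a state that satisfies `Q`. -/
def WP (N : ℕ) (P : Prog) (Q : State → Prop) (s : State) : Prop :=
  ∃ t ≤ P.time.eval N, ∃ s', Q s' ∧ Frame P s s' ∧
    ∀ k, step^[t] (s.config (P :: k)) = s'.config k

variable {N n : ℕ} {P P' : Prog} {Q Q' : State → Prop} {s : State} {e : Expr}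

lemma WP.mono (h : WP N P Q s) (hQ : ∀ s', Frame P s s' → Q s' → Q' s') : WP N P Q' s := by
  obtain ⟨t, ht, s', h₁, h₂, h₃⟩ := h
  exact ⟨t, ht, s', hQ s' h₂ h₁, h₂, h₃⟩

lemma WP.skip (h : Q s) : WP N .skip Q s :=
  ⟨1, by simp [Prog.time], s, h, .refl _ _, fun _ => rfl⟩

lemma WP.store {a : ℕ} {i : Expr} (h : Q (s.set a (i.eval s.mem) (e.eval s.mem))) :
    WP N (.store a i e) Q s :=
  ⟨1, by simp [Prog.time], _, h, .store s a i e, fun _ => rfl⟩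

lemma WP.write (h : Q { s with buf := s.buf ++ [decide (e.eval s.mem ≠ 0)] }) :
    WP N (.write e) Q s :=
  ⟨1, by simp [Prog.time], _, h, ⟨fun _ _ _ => rfl, by simp [Prog.silent], by simp [Prog.silent]⟩,
    fun _ => rfl⟩

lemma WP.emit (h : Q { s with buf := [], out := s.out ++ [s.buf] }) : WP N .emit Q s :=
  ⟨1, by simp [Prog.time], _, h, ⟨fun _ _ _ => rfl, by simp [Prog.silent], by simp [Prog.silent]⟩,
    fun _ => rfl⟩

lemma WP.seq (h : WP N P (WP N P' Q) s) : WP N (.seq P P') Q s := by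
  obtain ⟨t, ht, s₁, ⟨t', ht', s₂, hQ, hF', hrun'⟩, hF, hrun⟩ := h
  refine ⟨t' + (t + 1), ?_, s₂, hQ, .trans (hF.weaken ?_ ?_) (hF'.weaken ?_ ?_), fun k => ?_⟩
  · simp only [Prog.time, Polynomial.eval_add, Polynomial.eval_one]
    omega
  any_goals simp +contextual [Prog.writes, Prog.silent]
  rw [Function.iterate_add_apply, Function.iterate_succ_apply, ← hrun' k, ← hrun (P' :: k)]
  rfl

lemma WP.ite (h : e.eval s.mem ≠ 0 → WP N P Q s) (h' : e.eval s.mem = 0 → WP N P' Q s) :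
    WP N (.ite e P P') Q s := by
  set R := if e.eval s.mem ≠ 0 then P else P' with hR
  have hRs : R = P ∨ R = P' := by rw [hR]; split_ifs <;> simp
  have hWP : WP N R Q s := by
    rw [hR]
    split_ifs with he
    exacts [h he, h' (not_not.1 he)]
  obtain ⟨t, ht, s', hQ, hF, hrun⟩ := hWP
  refine ⟨t + 1, ?_, s', hQ, hF.weaken (fun a i => ?_) ?_, fun k => ?_⟩
  · simp only [Prog.time, Polynomial.eval_add, Polynomial.eval_one]
    rcases hRs with hRs | hRs <;> rw [hRs] at ht <;> omega
  · rcases hRs with hRs | hRs <;> simp +contextual [hRs, Prog.writes]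
  · rcases hRs with hRs | hRs <;> simp +contextual [hRs, Prog.silent]
  · rw [Function.iterate_succ_apply, ← hrun k]
    rfl

/-- The guard counts the remaining rounds, so it determines when the loop ends. -/
lemma WP.loop (I : ℕ → State → Prop) (hn : n ≤ N) (h₀ : I 0 s)
    (he : ∀ k ≤ n, ∀ s', Frame P s s' → I k s' → e.eval s'.mem = n - k)
    (hstep : ∀ k < n, ∀ s', Frame P s s' → I k s' → WP N P (I (k + 1)) s')
    (hQ : ∀ s', Frame P s s' → I n s' → Q s') : WP N (.loop e P) Q s := by
  have key : ∀ d ≤ n, ∀ s', Frame P s s' → I (n - d) s' →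
      ∃ t ≤ d * (P.time.eval N + 1) + 1, ∃ s'', Q s'' ∧ Frame P s s'' ∧
        ∀ k, step^[t] (s'.config (.loop e P :: k)) = s''.config k := by
    intro d
    induction d with
    | zero =>
      intro _ s' hF hI
      refine ⟨1, by simp, s', hQ s' hF hI, hF, fun k => ?_⟩
      simp [State.config, step, he n le_rfl s' hF hI]
    | succ d ih =>
      intro hd s' hF hI
      obtain ⟨t, ht, s₁, hI₁, hF₁, hrun₁⟩ := hstep (n - (d + 1)) (by omega) s' hF hI
      rw [show n - (d + 1) + 1 = n - d by omega] at hI₁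
      obtain ⟨t', ht', s₂, hQ₂, hF₂, hrun₂⟩ := ih (by omega) s₁ (hF.trans hF₁) hI₁
      refine ⟨t' + (t + 1), by rw [Nat.succ_mul]; omega, s₂, hQ₂, hF₂, fun k => ?_⟩
      have hguard := he (n - (d + 1)) (by omega) s' hF hI
      rw [Function.iterate_add_apply, Function.iterate_succ_apply, ← hrun₂ k, ← hrun₁]
      congr 2
      simp only [State.config, step]
      rw [if_pos (by omega)]
  obtain ⟨t, ht, s', hQ', hF, hrun⟩ := key n le_rfl s (.refl _ _) (by simpa using h₀)
  refine ⟨t, ht.trans ?_, s', hQ', ⟨hF.mem, hF.buf, hF.out⟩, hrun⟩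
  simp only [Prog.time, Polynomial.eval_add, Polynomial.eval_mul, Polynomial.eval_X,
    Polynomial.eval_one]
  gcongr

/-- The scalar variable `a`. -/
abbrev Expr.var (a : ℕ) : Expr := .cell a (.lit 0)

/-- The assignment of the value of `e` to the scalar variable `a`. -/
abbrev Prog.assign (a : ℕ) (e : Expr) : Prog := .store a (.lit 0) e

/-- Run `P` for the values `0, …, e - 1` of the scalar variable `i`. -/
def Prog.forLoop (i : ℕ) (e : Expr) (P : Prog) : Prog :=
  .seq (.assign i (.lit 0))
    (.loop (.sub e (.var i)) (.seq P (.assign i (.add (.var i) (.lit 1)))))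

lemma WP.assign {a : ℕ} (h : Q (s.set a 0 (e.eval s.mem))) : WP N (.assign a e) Q s := WP.store h

lemma WP.forLoop {i : ℕ} (I : ℕ → State → Prop) (hn : n ≤ N) (hi : P.writes i 0 = false)
    (hset : ∀ k s v, I k s → I k (s.set i 0 v)) (h₀ : I 0 s)
    (he : ∀ s', Frame (.forLoop i e P) s s' → e.eval s'.mem = n)
    (hstep : ∀ k < n, ∀ s', Frame (.forLoop i e P) s s' → s'.mem (i, 0) = k → I k s' →
      WP N P (I (k + 1)) s')
    (hQ : ∀ s', Frame (.forLoop i e P) s s' → I n s' → Q s') :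
    WP N (.forLoop i e P) Q s := by
  have hF : ∀ {s'}, Frame (.seq P (.assign i (.add (.var i) (.lit 1)))) (s.set i 0 0) s' →
      Frame (.forLoop i e P) s s' := fun h =>
    ((Frame.store s i (.lit 0) (.lit 0)).weaken (by simp +contextual [Prog.forLoop, Prog.writes])
      (by simp [Prog.silent])).trans
    (h.weaken (by simp [Prog.forLoop, Prog.writes]) (by simp [Prog.forLoop, Prog.silent]))
  refine WP.seq (WP.assign (WP.loop (n := n) (fun k s' => I k s' ∧ s'.mem (i, 0) = k) hn
    ⟨hset 0 s _ h₀, by simp [Expr.eval]⟩ ?_ ?_ fun s' h hI => hQ s' (hF h) hI.1))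
  · intro k _ s' h hI
    simp only [Expr.eval, he s' (hF h), hI.2]
  · intro k hk s' h hI
    refine WP.seq ((hstep k hk s' (hF h) hI.2 hI.1).mono fun s'' h'' hI'' =>
      WP.assign ⟨hset _ _ _ hI'', ?_⟩)
    simp [Expr.eval, h''.mem i 0 hi, hI.2]

/-- Run `P` for the values `0, …, e - 1` of the scalar variable `i`, while the scalar variable `p`,
initially `z`, is replaced by `next` after each round. -/
def Prog.walk (i p : ℕ) (z e next : Expr) (P : Prog) : Prog :=
  .seq (.assign p z) (.forLoop i e (.seq P (.assign p next)))

lemma WP.walk {i p : ℕ} {z next : Expr} (f : ℕ → ℕ) (I : ℕ → State → Prop) (hn : n ≤ N)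
    (hip : i ≠ p) (hi : P.writes i 0 = false) (hp : P.writes p 0 = false)
    (hset : ∀ k s v, I k s → I k (s.set i 0 v) ∧ I k (s.set p 0 v)) (h₀ : I 0 s)
    (hz : z.eval s.mem = f 0)
    (he : ∀ s', Frame (.walk i p z e next P) s s' → e.eval s'.mem = n)
    (hnext : ∀ k < n, ∀ s', Frame (.walk i p z e next P) s s' → s'.mem (p, 0) = f k →
      next.eval s'.mem = f (k + 1))
    (hstep : ∀ k < n, ∀ s', Frame (.walk i p z e next P) s s' → s'.mem (i, 0) = k →
      s'.mem (p, 0) = f k → I k s' → WP N P (I (k + 1)) s')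
    (hQ : ∀ s', Frame (.walk i p z e next P) s s' → s'.mem (p, 0) = f n → I n s' → Q s') :
    WP N (.walk i p z e next P) Q s := by
  have hF : ∀ {s'}, Frame (.forLoop i e (.seq P (.assign p next)))
      (s.set p 0 (z.eval s.mem)) s' → Frame (.walk i p z e next P) s s' := fun h =>
    ((Frame.store s p (.lit 0) z).weaken (by simp +contextual [Prog.walk, Prog.writes])
      (by simp [Prog.silent])).trans
    (h.weaken (by simp +contextual [Prog.walk, Prog.writes])
      (by simp +contextual [Prog.walk, Prog.silent]))
  refine WP.seq (WP.assign (WP.forLoop (fun k s' => I k s' ∧ s'.mem (p, 0) = f k) hn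
    (by simp [Prog.writes, hi, hip]) (fun k s v h => ⟨(hset k s v h.1).1, by simp [hip.symm, h.2]⟩)
    ⟨(hset 0 s _ h₀).2, by simp [hz]⟩ (fun s' h => he s' (hF h)) ?_
    fun s' h hI => hQ s' (hF h) hI.2 hI.1))
  intro k hk s' h hik hI
  refine WP.seq ((hstep k hk s' (hF h) hik hI.2 hI.1).mono fun s'' h'' hI'' =>
    WP.assign ⟨(hset _ _ _ hI'').2, ?_⟩)
  have hF'' : Frame (.walk i p z e next P) s s'' := (hF h).trans (h''.weaken
    (by simp +contextual [Prog.walk, Prog.forLoop, Prog.writes])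
    (by simp +contextual [Prog.walk, Prog.forLoop, Prog.silent]))
  simpa using hnext k hk s'' hF'' ((h''.mem p 0 hp).trans hI.2)

end ProgramLogic

/-! ### Growth of the memory -/

/-- A bound for the number of bits by which the value of an expression is longer than the contents
of the memory. -/
def Expr.growth : Expr → ℕ
  | lit n => Nat.size n
  | cell _ _ => 0
  | add e f => e.growth + f.growth + 1
  | sub e _ => e.growth

lemma size_add_le {a b n : ℕ} (ha : Nat.size a ≤ n) (hb : Nat.size b ≤ n) :
    Nat.size (a + b) ≤ n + 1 := by
  rw [Nat.size_le] at *
  rw [pow_succ]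
  omega

lemma Expr.size_eval_le {M : Mem} {B : ℕ} (h : ∀ x, Nat.size (M x) ≤ B) (e : Expr) :
    Nat.size (e.eval M) ≤ B + e.growth := by
  induction e with
  | lit n => simp [Expr.eval, Expr.growth]
  | cell a i _ => exact (h _).trans (by simp [Expr.growth])
  | add e f he hf =>
    simp only [Expr.eval, Expr.growth]
    refine (size_add_le (n := B + e.growth + f.growth) ?_ ?_).trans ?_ <;> omega
  | sub e f he _ => exact (Nat.size_le_size (Nat.sub_le _ _)).trans he

/-- A bound for the growth of `Bounded` in a single step of a program. -/
def Prog.growth : Prog → ℕ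
  | store a i e => Nat.size a + i.growth + e.growth + 1
  | seq P Q => P.growth + Q.growth
  | ite _ P Q => P.growth + Q.growth
  | loop _ P => P.growth
  | _ => 0

/-- At most `B` cells are in use, and their addresses and contents have at most `B` bits each. -/
structure Bounded (B : ℕ) (M : Mem) : Prop where
  card : M.support.card ≤ B
  array : ∀ x, M x ≠ 0 → Nat.size x.1 ≤ B
  index : ∀ x, M x ≠ 0 → Nat.size x.2 ≤ B
  value : ∀ x, Nat.size (M x) ≤ B

lemma Bounded.space_le {B : ℕ} {c : Config} (h : Bounded B c.mem) : c.space ≤ B * (3 * B) := by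
  refine (Finset.sum_le_card_nsmul _ _ (3 * B) fun x hx => ?_).trans ?_
  · have hx := Finsupp.mem_support_iff.1 hx
    have := h.array x hx
    have := h.index x hx
    have := h.value x
    dsimp only
    omega
  · rw [smul_eq_mul]
    exact Nat.mul_le_mul_right _ h.card

lemma Bounded.of_eq_off {B B' : ℕ} {M M' : Mem} {T : Finset (ℕ × ℕ)} (h : Bounded B M)
    (hB : B + T.card ≤ B') (hM : ∀ x ∉ T, M' x ≠ 0 → M' x = M x)
    (hT : ∀ x ∈ T, Nat.size x.1 ≤ B' ∧ Nat.size x.2 ≤ B' ∧ Nat.size (M' x) ≤ B') :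
    Bounded B' M' where
  card := by
    classical
    refine (Finset.card_le_card (t := M.support ∪ T) fun x hx => ?_).trans
      ((Finset.card_union_le _ _).trans (by have := h.card; omega))
    by_contra hx'
    simp only [Finset.mem_union, not_or] at hx'
    rw [Finsupp.mem_support_iff] at hx
    exact hx'.1 (Finsupp.mem_support_iff.2 (hM x hx'.2 hx ▸ hx))
  array x hx := by
    by_cases hxT : x ∈ T
    · exact (hT x hxT).1
    · exact (h.array x (by rwa [← hM x hxT hx])).trans (by omega)
  index x hx := by
    by_cases hxT : x ∈ T
    · exact (hT x hxT).2.1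
    · exact (h.index x (by rwa [← hM x hxT hx])).trans (by omega)
  value x := by
    by_cases hxT : x ∈ T
    · exact (hT x hxT).2.2
    · rcases eq_or_ne (M' x) 0 with hx | hx
      · simp [hx]
      · exact hM x hxT hx ▸ (h.value x).trans (by omega)

lemma Bounded.mono {B B' : ℕ} {M : Mem} (h : Bounded B M) (hB : B ≤ B') : Bounded B' M :=
  h.of_eq_off (T := ∅) (by simpa using hB) (fun _ _ _ => rfl) (by simp)

lemma Bounded.of_bits {B A L : ℕ} {M M' : Mem} (h : Bounded B M)
    (hM : ∀ x, M' x = M x ∨ M' x = 0 ∨ x.1 < A ∧ x.2 < L ∧ M' x = 1) :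
    Bounded (B + A * L) M' := by
  have hsize : ∀ n, Nat.size n ≤ n := fun n => Nat.size_le.2 n.lt_two_pow_self
  refine h.of_eq_off (T := Finset.range A ×ˢ Finset.range L) (by simp) (fun x hx hx' => ?_)
    fun ⟨a, i⟩ hx => ?_
  · exact (hM x).resolve_right fun h => h.elim hx' fun h => hx (by simp [h.1, h.2.1])
  · simp only [Finset.mem_product, Finset.mem_range] at hx
    have hA : A ≤ A * L := Nat.le_mul_of_pos_right A (by omega)
    have hL : L ≤ A * L := Nat.le_mul_of_pos_left L (by omega)
    have := hsize a
    have := hsize i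
    refine ⟨by dsimp only; omega, by dsimp only; omega, ?_⟩
    rcases hM (a, i) with h' | h' | h'
    · rw [h']
      exact (h.value _).trans (Nat.le_add_right _ _)
    · simp [h']
    · rw [h'.2.2, Nat.size_one]
      omega

lemma Bounded.store {B g a : ℕ} {i e : Expr} {M : Mem} (h : Bounded B M)
    (hg : (Prog.store a i e).growth ≤ g) :
    Bounded (B + g) (M.update (a, i.eval M) (e.eval M)) := by
  have hi := i.size_eval_le h.value
  have he := e.size_eval_le h.value
  simp only [Prog.growth] at hg
  refine h.of_eq_off (T := {(a, i.eval M)}) (by simp; omega) (fun x hx _ => ?_) fun x hx => ?_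
  · simp_all
  · obtain rfl := Finset.mem_singleton.1 hx
    simp only [Finsupp.coe_update, Function.update_self]
    omega

/-- The memory is bounded by `B`, and no program that remains to be executed has growth more than
`g`. -/
structure Config.Tame (B g : ℕ) (c : Config) : Prop where
  mem : Bounded B c.mem
  code : ∀ P ∈ c.code, P.growth ≤ g

lemma Config.Tame.step {B g : ℕ} {c : Config} (h : c.Tame B g) : (step c).Tame (B + g) g := by
  have hM : Bounded (B + g) c.mem := h.mem.mono (Nat.le_add_right _ _)
  obtain ⟨_ | ⟨P, k⟩, M, b, o⟩ := c
  · exact ⟨hM, h.code⟩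
  obtain ⟨hP, hk⟩ := List.forall_mem_cons.1 h.code
  cases P with
  | skip | write e | emit => exact ⟨hM, hk⟩
  | store a i e => exact ⟨h.mem.store hP, hk⟩
  | seq P Q =>
    simp only [Prog.growth] at hP
    exact ⟨hM, by simp only [RAM.step, List.forall_mem_cons]; exact ⟨by omega, by omega, hk⟩⟩
  | ite e P Q =>
    simp only [Prog.growth] at hP
    refine ⟨hM, ?_⟩
    simp only [RAM.step, List.forall_mem_cons]
    exact ⟨by split_ifs <;> omega, hk⟩
  | loop e P =>
    refine ⟨hM, ?_⟩
    simp only [RAM.step]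
    split_ifs
    · exact List.forall_mem_cons.2 ⟨hP, h.code⟩
    · exact hk

lemma Config.Tame.iterate {B g : ℕ} {c : Config} (h : c.Tame B g) (t : ℕ) :
    (RAM.step^[t] c).Tame (B + t * g) g := by
  induction t with
  | zero => simpa using h
  | succ t ih =>
    rw [Function.iterate_succ_apply', Nat.succ_mul, ← Nat.add_assoc]
    exact ih.step

lemma length_le_inputSize (w : List ℕ) : w.length ≤ inputSize w := by
  simp [inputSize]

lemma size_getD_le_inputSize (w : List ℕ) (i : ℕ) : Nat.size (w.getD i 0) ≤ inputSize w := by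
  rcases lt_or_ge i w.length with hi | hi
  · rw [List.getD_eq_getElem _ _ hi]
    exact (Nat.le_succ _).trans
      (List.le_sum_of_mem (List.mem_map_of_mem (f := fun n => Nat.size n + 1) (w.getElem_mem hi)))
  · rw [List.getD_eq_default _ _ hi, Nat.size_zero]
    exact Nat.zero_le _

lemma inputMem_apply (w : List ℕ) (a i : ℕ) :
    inputMem w (a, i) = if a = 0 then w.getD i 0 else 0 := rfl

lemma inputMem_bounded (w : List ℕ) : Bounded (inputSize w) (inputMem w) := by
  have hlen := length_le_inputSize w
  have hcell : ∀ x, inputMem w x ≠ 0 → x.1 = 0 ∧ x.2 < w.length := by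
    rintro ⟨a, i⟩ h
    rw [inputMem_apply] at h
    refine ⟨by_contra fun ha => h (if_neg ha), by_contra fun hi => h ?_⟩
    rw [List.getD_eq_default _ _ (not_lt.1 hi), ite_self]
  refine ⟨?_, fun x hx => ?_, fun x hx => ?_, ?_⟩
  · exact (Finset.card_le_card Finsupp.support_onFinset_subset).trans (by simpa using hlen)
  · simp [(hcell x hx).1]
  · have hsize : Nat.size x.2 ≤ x.2 := Nat.size_le.2 x.2.lt_two_pow_self
    have := (hcell x hx).2
    omega
  · rintro ⟨a, i⟩
    rw [inputMem_apply]
    split_ifs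
    · exact size_getD_le_inputSize w i
    · simp

/-! ### Enumeration in rounds -/

lemma length_out_le_step (c : Config) : c.out.length ≤ (step c).out.length := by
  obtain ⟨code, M, b, o⟩ := c
  rcases code with _ | ⟨_ | _ | _ | _ | _ | _ | _, k⟩ <;> simp [step]

lemma length_out_mono (c : Config) : Monotone fun t => (step^[t] c).out.length :=
  monotone_nat_of_le_succ fun t => by
    simpa only [Function.iterate_succ_apply'] using length_out_le_step _

lemma Config.Halted.iterate {c : Config} (h : c.Halted) (t : ℕ) : step^[t] c = c := by
  obtain ⟨code, M, b, o⟩ := c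
  obtain rfl : code = [] := h
  exact Function.iterate_fixed rfl t

lemma Config.Halted.of_le {c : Config} {t t' : ℕ} (h : (step^[t] c).Halted) (ht : t ≤ t') :
    (step^[t'] c).Halted := by
  obtain ⟨d, rfl⟩ := Nat.exists_eq_add_of_le' ht
  rwa [Function.iterate_add_apply, h.iterate]

/-- Within `D` steps there is an output or the machine has halted. -/
def Config.Progress (D : ℕ) (c : Config) : Prop :=
  c.out.length < (step^[D] c).out.length ∨ (step^[D] c).Halted

lemma Config.Progress.of_out {D t : ℕ} {c : Config} (ht : t ≤ D)
    (h : c.out.length < (step^[t] c).out.length) : c.Progress D :=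
  .inl (h.trans_le (length_out_mono c ht))

lemma Config.Progress.of_halted {D t : ℕ} {c : Config} (ht : t ≤ D)
    (h : (step^[t] c).Halted) : c.Progress D :=
  .inr (h.of_le ht)

lemma Config.Progress.of_iterate {D D' t : ℕ} {c : Config} (h : (step^[t] c).Progress D)
    (ht : t + D ≤ D') : c.Progress D' := by
  rw [Progress, ← Function.iterate_add_apply] at h
  exact h.elim
    (fun h => .of_out (by omega) ((length_out_mono c t.zero_le).trans_lt h))
    (.of_halted (by omega))

/-- From `c` on the machine runs with delay `D` and in space `S`, and when it halts the list of its
outputs has the property `Good`. -/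
structure Paced (D S : ℕ) (Good : List (List Bool) → Prop) (c : Config) : Prop where
  halts : ∃ T, (step^[T] c).Halted ∧ Good (step^[T] c).out
  delay : ∀ t, (step^[t] c).Progress D
  space : ∀ t, (step^[t] c).space ≤ S

lemma Paced.of_halted {D S : ℕ} {Good : List (List Bool) → Prop} {c : Config} (h : c.Halted)
    (hGood : Good c.out) (hS : c.space ≤ S) : Paced D S Good c where
  halts := ⟨0, h, hGood⟩
  delay t := .of_halted (t := 0) D.zero_le (by rwa [h.iterate, h.iterate])
  space t := by rwa [h.iterate]

lemma Paced.prepend {D S n : ℕ} {Good : List (List Bool) → Prop} {c : Config}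
    (h : Paced (2 * D) S Good (step^[n] c)) (hn : n ≤ D) (hp : (step^[n] c).Progress D)
    (hS : ∀ t ≤ n, (step^[t] c).space ≤ S) : Paced (2 * D) S Good c where
  halts := by
    obtain ⟨T, h⟩ := h.halts
    exact ⟨T + n, by rwa [Function.iterate_add_apply]⟩
  delay t := by
    rcases le_total n t with ht | ht
    · obtain ⟨d, rfl⟩ := Nat.exists_eq_add_of_le' ht
      rw [Function.iterate_add_apply]
      exact h.delay d
    · obtain ⟨d, rfl⟩ := Nat.exists_eq_add_of_le' ht
      rw [Function.iterate_add_apply] at hp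
      exact hp.of_iterate (by omega)
  space t := by
    rcases le_total n t with ht | ht
    · obtain ⟨d, rfl⟩ := Nat.exists_eq_add_of_le' ht
      rw [Function.iterate_add_apply]
      exact h.space d
    · exact hS t ht

/-- The space that suffices for `D` steps of programs of growth at most `g` from a memory bounded
by `B`. -/
def spaceBound (B D g : ℕ) : ℕ := (B + D * g) * (3 * (B + D * g))

lemma Config.Tame.space_le {B B' D g t : ℕ} {c : Config} (h : c.Tame B g) (hB : B ≤ B')
    (ht : t ≤ D) : (RAM.step^[t] c).space ≤ spaceBound B' D g := by
  refine (h.iterate t).mem.space_le.trans ?_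
  unfold spaceBound
  gcongr

/-- `I` is an invariant of a loop of `n` rounds with guard `e` and body `P`, entered in the state
`s₀`, each round of which contributes an output, so that after the last round precisely the elements
of `S` have been output. Its body terminates if loops have at most `N` rounds, and at the beginning
of every round the memory exceeds the bounds for `s₀` by at most `b`. -/
structure EnumInvariant (N b : ℕ) (e : Expr) (P : Prog) (S : Set (List Bool)) (s₀ : State) (n : ℕ)
    (I : ℕ → State → Prop) : Prop where
  entry : I 0 s₀
  guard : ∀ k ≤ n, ∀ s, I k s → (e.eval s.mem ≠ 0 ↔ k < n)
  round : ∀ k < n, ∀ s, I k s →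
    WP N P (fun s' => I (k + 1) s' ∧ s.out.length < s'.out.length) s
  bounded : ∀ k s, I k s → ∀ B, Bounded B s₀.mem → Bounded (B + b) s.mem
  final : ∀ s, I n s → s.out.Nodup ∧ {w | w ∈ s.out} = S

lemma EnumInvariant.paced {N b B D n k : ℕ} {e : Expr} {P : Prog} {S : Set (List Bool)}
    {s₀ s : State} {I : ℕ → State → Prop} (h : EnumInvariant N b e P S s₀ n I)
    (hB : Bounded B s₀.mem) (hD : P.time.eval N + 1 ≤ D) (hk : k ≤ n) (hI : I k s) (g : ℕ)
    (hg : P.growth ≤ g) :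
    Paced (2 * D) (spaceBound (B + b) D g) (fun o => o.Nodup ∧ {w | w ∈ o} = S)
      (s.config [.loop e P]) ∧ (s.config [.loop e P]).Progress D := by
  have hspace : ∀ k s, I k s → ∀ t ≤ D,
      (step^[t] (s.config [.loop e P])).space ≤ spaceBound (B + b) D g := fun k s hI t ht =>
    Config.Tame.space_le ⟨h.bounded k s hI B hB, by simpa [State.config, Prog.growth]⟩ le_rfl ht
  induction hk using Nat.decreasingInduction generalizing s with
  | self =>
    have hstep : step^[1] (s.config [.loop e P]) = s.config [] := by
      simp [State.config, step, not_not.1 (mt (h.guard n le_rfl s hI).1 (lt_irrefl n))]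
    have hhalted : (step^[1] (s.config [.loop e P])).Halted := by rw [hstep]; rfl
    refine ⟨.prepend (n := 1) (.of_halted hhalted ?_ (hspace _ _ hI _ (by omega))) (by omega)
      (.of_halted D.zero_le hhalted) fun t ht => hspace _ _ hI _ (by omega),
      .of_halted (t := 1) (by omega) hhalted⟩
    rw [hstep]
    exact h.final s hI
  | of_succ k hk ih =>
    obtain ⟨t, ht, s', ⟨hI', hout⟩, -, hrun⟩ := h.round k hk s hI
    have hstep : step^[t + 1] (s.config [.loop e P]) = s'.config [.loop e P] := by
      rw [Function.iterate_succ_apply, ← hrun]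
      simp [State.config, step, (h.guard k hk.le s hI).2 hk]
    obtain ⟨hpaced, hprogress⟩ := ih hI'
    rw [← hstep] at hpaced hprogress
    refine ⟨hpaced.prepend (by omega) hprogress fun t' ht' => hspace _ _ hI _ (by omega),
      .of_out (t := t + 1) (by omega) ?_⟩
    rwa [hstep]

/-- A preprocessing that depends polynomially on the input, followed by a loop with one output in
each round. -/
theorem enumerable_of_loop {α : Type} {enc : α → List ℕ} {sols : α → Set (List Bool)} {P Q : Prog}
    {e : Expr} (b : Polynomial ℕ)
    (h : ∀ x, WP (inputSize (enc x)) P (fun s₀ => ∃ n I,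
      EnumInvariant (inputSize (enc x)) (b.eval (inputSize (enc x))) e Q (sols x) s₀ n I)
      ⟨inputMem (enc x), [], []⟩) :
    EnumerableWithPolyDelayPolySpace enc sols := by
  let D : Polynomial ℕ := P.time + Q.time + 1
  let g : ℕ := (Prog.seq P (.loop e Q)).growth
  let A : Polynomial ℕ := .X + D * .C g + b
  refine ⟨.seq P (.loop e Q), 2 * D, (A + D * .C g) * (3 * (A + D * .C g)), fun x => ?_⟩
  obtain ⟨t, ht, s₀, ⟨n, I, hI⟩, -, hrun⟩ := h x
  set N := inputSize (enc x)
  have hD : D.eval N = P.time.eval N + Q.time.eval N + 1 := by simp [D]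
  have hA : A.eval N = N + D.eval N * g + b.eval N := by simp [A]
  let c : Config := ⟨[.seq P (.loop e Q)], inputMem (enc x), [], []⟩
  have hc : c.Tame N g := ⟨inputMem_bounded _, by simp [c, g]⟩
  have hhead : step^[t + 1] c = s₀.config [.loop e Q] := by
    rw [Function.iterate_succ_apply, ← hrun]
    rfl
  have hB : Bounded (N + D.eval N * g) s₀.mem := by
    refine Bounded.mono (B := N + (t + 1) * g) ?_ (by gcongr; omega)
    rw [show s₀.mem = (step^[t + 1] c).mem by rw [hhead]; rfl]
    exact (hc.iterate (t + 1)).mem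
  obtain ⟨hpaced, hprogress⟩ :=
    hI.paced (D := D.eval N) hB (by omega) n.zero_le hI.entry g (by simp [g, Prog.growth])
  rw [← hhead, ← hA] at hpaced
  rw [← hhead] at hprogress
  have key := hpaced.prepend (by omega) hprogress fun t' ht' =>
    hc.space_le (by rw [hA, add_assoc]; omega) (by omega)
  refine ⟨key.halts, fun t' => ?_, fun t' => ?_⟩
  · rw [run, run, Nat.add_comm, Function.iterate_add_apply, Polynomial.eval_mul,
      Polynomial.eval_ofNat]
    exact key.delay t'
  · simpa [spaceBound, run] using key.space t'

end RAM

/-! ### Row echelon form -/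

/-- The square matrix with rows `E 0, …, E (m - 1)` is in row echelon form, the leading entry of
each nonzero row being placed on the diagonal; the rows and the entries from `m` on are zero. -/
structure Echelon {R : Type*} [Zero R] (m : ℕ) (E : ℕ → ℕ → R) : Prop where
  support_subset : ∀ i, Function.support (E i) ⊆ Set.Ico i m
  eq_zero : ∀ i, E i i = 0 → E i = 0

namespace Echelon

lemma zero {R : Type*} [Zero R] (m : ℕ) : Echelon m (0 : ℕ → ℕ → R) where
  support_subset := by simp
  eq_zero _ _ := rfl

lemma apply_eq_zero {R : Type*} [Zero R] {m i j : ℕ} {E : ℕ → ℕ → R} (hE : Echelon m E)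
    (hj : j < i) : E i j = 0 :=
  Function.notMem_support.1 fun h => hj.not_ge (hE.support_subset i h).1

lemma apply_eq_zero_of_le {R : Type*} [Zero R] {m i j : ℕ} {E : ℕ → ℕ → R} (hE : Echelon m E)
    (hj : m ≤ j) : E i j = 0 :=
  Function.notMem_support.1 fun h => hj.not_gt (hE.support_subset i h).2

lemma row_eq_zero {R : Type*} [Zero R] {m i : ℕ} {E : ℕ → ℕ → R} (hE : Echelon m E)
    (hi : m ≤ i) : E i = 0 :=
  hE.eq_zero i (hE.apply_eq_zero_of_le hi)

lemma update {R : Type*} [Zero R] {m k : ℕ} {E : ℕ → ℕ → R} (hE : Echelon m E) {u : ℕ → R}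
    (hu : Function.support u ⊆ Set.Ico k m) (huk : u k ≠ 0) :
    Echelon m (Function.update E k u) := by
  constructor <;> intro i <;> rcases eq_or_ne i k with rfl | hi
  · rwa [Function.update_self]
  · rw [Function.update_of_ne hi]
    exact hE.support_subset i
  · rw [Function.update_self]
    exact fun h => absurd h huk
  · rw [Function.update_of_ne hi]
    exact hE.eq_zero i

lemma coeff_eq_zero {R : Type*} [Semiring R] [NoZeroDivisors R] {m : ℕ} {E : ℕ → ℕ → R}
    (hE : Echelon m E) {c : ℕ → R} (hc : ∀ j, E j j = 0 → c j = 0)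
    (h : ∑ j ∈ Finset.range m, c j • E j = 0) (i : ℕ) : c i = 0 := by
  induction i using Nat.strong_induction_on with
  | _ i ih =>
    rcases lt_or_ge i m with hi | hi
    · have hsum : ∑ j ∈ Finset.range m, c j * E j i = c i * E i i := by
        refine Finset.sum_eq_single i (fun j _ hj => ?_) (by simp [hi])
        rcases hj.lt_or_gt with hj | hj
        · rw [ih j hj, zero_mul]
        · rw [hE.apply_eq_zero hj, mul_zero]
      have hdiag : c i * E i i = 0 := by
        rw [← hsum]
        simpa using congrFun h i
      exact (mul_eq_zero.1 hdiag).elim id (hc i)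
    · exact hc i (by simp [hE.row_eq_zero hi])

lemma mem_span_range {R : Type*} [Semiring R] {m : ℕ} {E : ℕ → ℕ → R} (hE : Echelon m E)
    {u : ℕ → R} :
    u ∈ Submodule.span R (Set.range E) ↔ ∃ c : ℕ → R, ∑ j ∈ Finset.range m, c j • E j = u := by
  constructor
  · rw [Finsupp.mem_span_range_iff_exists_finsupp]
    rintro ⟨c, rfl⟩
    refine ⟨c, ?_⟩
    rw [Finsupp.sum_of_support_subset c (Finset.subset_union_left (s₂ := Finset.range m)) _
      (by simp)]
    refine Finset.sum_subset Finset.subset_union_right fun j _ hj => ?_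
    rw [hE.row_eq_zero (by simpa using hj), smul_zero]
  · rintro ⟨c, rfl⟩
    exact Submodule.sum_smul_mem _ _ fun j _ => Submodule.subset_span (Set.mem_range_self j)

end Echelon

lemma span_insert_add {R M : Type*} [Ring R] [AddCommGroup M] [Module R M] {u w : M} {S : Set M}
    (hw : w ∈ Submodule.span R S) :
    Submodule.span R (insert (u + w) S) = Submodule.span R (insert u S) := by
  have hle : ∀ {u w : M}, w ∈ Submodule.span R S →
      Submodule.span R (insert (u + w) S) ≤ Submodule.span R (insert u S) := by
    intro u w hw
    refine Submodule.span_le.2 (Set.insert_subset ?_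
      ((Set.subset_insert u S).trans Submodule.subset_span))
    exact add_mem (Submodule.subset_span (Set.mem_insert u S))
      (Submodule.span_mono (Set.subset_insert u S) hw)
  refine le_antisymm (hle hw) ?_
  simpa using hle (u := u + w) (neg_mem hw)

lemma span_insert_range_update {R M ι : Type*} [Semiring R] [AddCommMonoid M] [Module R M]
    [DecidableEq ι] {E : ι → M} {k : ι} (hk : E k = 0) (u : M) :
    Submodule.span R (insert u (Set.range (Function.update E k u))) =
      Submodule.span R (insert u (Set.range E)) := by
  refine le_antisymm (Submodule.span_mono ?_) (Submodule.span_le.2 ?_)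
  · rintro _ (rfl | ⟨i, rfl⟩)
    · exact Set.mem_insert _ _
    · rcases eq_or_ne i k with rfl | hi
      · simp
      · exact .inr ⟨i, by rw [Function.update_of_ne hi]⟩
  · rintro _ (rfl | ⟨i, rfl⟩)
    · exact Submodule.subset_span (Set.mem_insert _ _)
    · rcases eq_or_ne i k with rfl | hi
      · simp [hk]
      · exact Submodule.subset_span (.inr ⟨i, by rw [Function.update_of_ne hi]⟩)

lemma support_subset_Ico_succ {R : Type*} [Zero R] {u : ℕ → R} {k m : ℕ}
    (hu : Function.support u ⊆ Set.Ico k m) (huk : u k = 0) :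
    Function.support u ⊆ Set.Ico (k + 1) m := fun j hj =>
  ⟨Nat.lt_of_le_of_ne (hu hj).1 (by rintro rfl; exact hj huk), (hu hj).2⟩

/-- The vector `u` is being inserted into the echelon form `E`: its entries before `k` have been
eliminated, and the space that is spanned in the end is `W`. -/
structure Elimination (m k : ℕ) (W : Submodule (ZMod 2) (ℕ → ZMod 2)) (E : ℕ → ℕ → ZMod 2)
    (u : ℕ → ZMod 2) : Prop where
  echelon : Echelon m E
  support_subset : Function.support u ⊆ Set.Ico k m
  span_eq : Submodule.span (ZMod 2) (insert u (Set.range E)) = W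

namespace Elimination

variable {m k : ℕ} {W : Submodule (ZMod 2) (ℕ → ZMod 2)} {E : ℕ → ℕ → ZMod 2} {u : ℕ → ZMod 2}

lemma skip (h : Elimination m k W E u) (huk : u k = 0) : Elimination m (k + 1) W E u :=
  ⟨h.echelon, support_subset_Ico_succ h.support_subset huk, h.span_eq⟩

lemma reduce (h : Elimination m k W E u) (huk : u k ≠ 0) (hEk : E k k ≠ 0) :
    Elimination m (k + 1) W E (u + E k) where
  echelon := h.echelon
  support_subset := by
    refine support_subset_Ico_succ ((Function.support_add _ _).trans
      (Set.union_subset h.support_subset (h.echelon.support_subset k))) ?_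
    rw [Pi.add_apply, Fin.eq_one_of_ne_zero _ huk, Fin.eq_one_of_ne_zero _ hEk]
    rfl
  span_eq := by
    rw [span_insert_add (Submodule.subset_span (Set.mem_range_self k)), h.span_eq]

lemma place (h : Elimination m k W E u) (huk : u k ≠ 0) (hEk : E k k = 0) :
    Elimination m k W (Function.update E k u) u :=
  ⟨h.echelon.update h.support_subset huk, h.support_subset, by
    rw [span_insert_range_update (h.echelon.eq_zero k hEk), h.span_eq]⟩

lemma eq_zero (h : Elimination m m W E u) : u = 0 := by
  simpa using h.support_subset

lemma span_range (h : Elimination m m W E u) : Submodule.span (ZMod 2) (Set.range E) = W := by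
  simpa [h.eq_zero] using h.span_eq

end Elimination

/-! ### Counting through a linear span over the two-element field -/

/-- The binary digits of `K`, least significant first, distributed to the places with property
`p`. -/
def digit (p : ℕ → Prop) [DecidablePred p] (K j : ℕ) : ZMod 2 :=
  if p j then (K / 2 ^ Nat.count p j : ℕ) else 0

/-- The places at which the binary digits of `K` and `K + 1` differ. -/
def flips (p : ℕ → Prop) [DecidablePred p] (K j : ℕ) : ZMod 2 :=
  if p j ∧ 2 ^ Nat.count p j ∣ K + 1 then 1 else 0

section Digit

variable {p : ℕ → Prop} [DecidablePred p]

lemma digit_zero : digit p 0 = 0 := by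
  funext j
  simp [digit]

lemma digit_succ (K : ℕ) : digit p (K + 1) = digit p K + flips p K := by
  funext j
  rw [Pi.add_apply, digit, digit, flips]
  by_cases hj : p j
  · rw [if_pos hj, if_pos hj, Nat.succ_div]
    simp [hj]
  · simp [hj]

lemma two_pow_count_succ_dvd_iff (K j : ℕ) : 2 ^ Nat.count p (j + 1) ∣ K + 1 ↔
    2 ^ Nat.count p j ∣ K + 1 ∧ (p j → digit p K j = 1) := by
  rw [Nat.count_succ, digit]
  by_cases hj : p j
  · simp only [hj, if_true, true_imp_iff, pow_succ]
    constructor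
    · intro h
      have hdvd := dvd_of_mul_right_dvd h
      refine ⟨hdvd, ?_⟩
      have heven := (ZMod.natCast_eq_zero_iff _ _).2 ((Nat.dvd_div_iff_mul_dvd hdvd).2 h)
      rw [Nat.succ_div, if_pos hdvd, Nat.cast_add, Nat.cast_one] at heven
      exact CharTwo.add_eq_zero.1 heven
    · rintro ⟨hdvd, hodd⟩
      rw [← Nat.dvd_div_iff_mul_dvd hdvd, ← ZMod.natCast_eq_zero_iff, Nat.succ_div, if_pos hdvd,
        Nat.cast_add, hodd]
      decide
  · simp [hj]

lemma digit_inj {m K K' : ℕ} (hK : K < 2 ^ Nat.count p m) (hK' : K' < 2 ^ Nat.count p m)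
    (h : ∀ j < m, digit p K j = digit p K' j) : K = K' := by
  refine Nat.eq_of_testBit_eq fun i => ?_
  rcases lt_or_ge i (Nat.count p m) with hi | hi
  · have hcard : ∀ hp : (Set.ofPred p).Finite, i < hp.toFinset.card := fun hp =>
      hi.trans_le (Nat.count_le_card hp m)
    have hdigit := h _ (Nat.nth_lt_of_lt_count hi)
    rw [digit, digit, if_pos (Nat.nth_mem i hcard), if_pos (Nat.nth_mem i hcard),
      Nat.count_nth hcard, ZMod.natCast_eq_natCast_iff'] at hdigit
    rw [Nat.testBit_eq_decide_div_mod_eq, Nat.testBit_eq_decide_div_mod_eq, hdigit]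
  · rw [Nat.testBit_lt_two_pow (hK.trans_le (Nat.pow_le_pow_right two_pos hi)),
      Nat.testBit_lt_two_pow (hK'.trans_le (Nat.pow_le_pow_right two_pos hi))]

lemma exists_digit_eq (m : ℕ) (c : ℕ → ZMod 2) :
    ∃ K < 2 ^ Nat.count p m, ∀ j < m, p j → digit p K j = c j := by
  refine ⟨Nat.ofBits fun i : Fin (Nat.count p m) => decide (c (Nat.nth p i) = 1),
    Nat.ofBits_lt_two_pow _, fun j hj hpj => ?_⟩
  have hlt : Nat.count p j < Nat.count p m := Nat.count_strict_mono hpj hj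
  have hbit := Nat.testBit_ofBits_lt
    (fun i : Fin (Nat.count p m) => decide (c (Nat.nth p i) = 1)) _ hlt
  rw [Nat.nth_count hpj, Nat.testBit_eq_decide_div_mod_eq, decide_eq_decide] at hbit
  have hval : ∀ x y : ZMod 2, (x.val = 1 ↔ y = 1) → x = y := by decide
  rw [digit, if_pos hpj]
  exact hval _ _ (by rwa [ZMod.val_natCast])

end Digit

/-- The number of nonzero rows of the echelon form `E`. -/
def rank (m : ℕ) (E : ℕ → ℕ → ZMod 2) : ℕ := Nat.count (fun j => E j j ≠ 0) m

/-- The linear combination of the rows of the echelon form `E` whose coefficients are the binary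
digits of `K`. -/
def combination (m : ℕ) (E : ℕ → ℕ → ZMod 2) (K : ℕ) : ℕ → ZMod 2 :=
  ∑ j ∈ Finset.range m, digit (fun j => E j j ≠ 0) K j • E j

lemma combination_zero (m : ℕ) (E : ℕ → ℕ → ZMod 2) : combination m E 0 = 0 := by
  simp [combination, digit_zero]

lemma combination_succ (m : ℕ) (E : ℕ → ℕ → ZMod 2) (K : ℕ) : combination m E (K + 1) =
    combination m E K + ∑ j ∈ Finset.range m, flips (fun j => E j j ≠ 0) K j • E j := by
  simp only [combination, digit_succ, Pi.add_apply, add_smul, Finset.sum_add_distrib]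

lemma Echelon.bijOn_combination {m : ℕ} {E : ℕ → ℕ → ZMod 2} (hE : Echelon m E) :
    Set.BijOn (combination m E) (Set.Iio (2 ^ rank m E))
      (Submodule.span (ZMod 2) (Set.range E)) := by
  refine ⟨fun K _ => hE.mem_span_range.2 ⟨_, rfl⟩, fun K hK K' hK' h => ?_, fun u hu => ?_⟩
  · refine digit_inj hK hK' fun j _ => sub_eq_zero.1
      (hE.coeff_eq_zero (c := digit _ K - digit _ K') (fun j hj => ?_) ?_ j)
    · simp [digit, hj]
    · simpa only [combination, Pi.sub_apply, sub_smul, Finset.sum_sub_distrib] using sub_eq_zero.2 h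
  · obtain ⟨c, rfl⟩ := hE.mem_span_range.1 hu
    obtain ⟨K, hK, hKc⟩ := exists_digit_eq (p := fun j => E j j ≠ 0) m c
    refine ⟨K, hK, Finset.sum_congr rfl fun j hj => ?_⟩
    by_cases hEj : E j j = 0
    · rw [hE.eq_zero j hEj, smul_zero, smul_zero]
    · rw [hKc j (Finset.mem_range.1 hj) hEj]

namespace XorCNF

/-! ### Signatures as an affine space -/

/-- The vector whose entry number `c` is the value of `f` at clause number `c`, and 0 from
`φ.length` on. -/
def clausewise {R : Type*} [Zero R] (φ : XorCNF) (f : XorClause → R) : ℕ → R :=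
  fun c => φ[c]?.elim 0 f

lemma clausewise_of_lt {R : Type*} [Zero R] {φ : XorCNF} {c : ℕ} (hc : c < φ.length)
    (f : XorClause → R) : φ.clausewise f c = f φ[c] := by
  rw [clausewise, List.getElem?_eq_getElem hc, Option.elim_some]

lemma clausewise_of_ge {R : Type*} [Zero R] {φ : XorCNF} {c : ℕ} (hc : φ.length ≤ c)
    (f : XorClause → R) : φ.clausewise f c = 0 := by
  rw [clausewise, List.getElem?_eq_none hc, Option.elim_none]

lemma support_clausewise_subset {R : Type*} [Zero R] (φ : XorCNF) (f : XorClause → R) :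
    Function.support (φ.clausewise f) ⊆ Set.Iio φ.length := fun _ hc =>
  not_le.1 fun h => hc (clausewise_of_ge h f)

lemma clausewise_ext {R : Type*} [Zero R] {φ : XorCNF} {f : XorClause → R} {u : ℕ → R}
    (h : ∀ c (hc : c < φ.length), u c = f φ[c]) (h' : ∀ c, φ.length ≤ c → u c = 0) :
    u = φ.clausewise f := by
  funext c
  rcases lt_or_ge c φ.length with hc | hc
  · rw [h c hc, clausewise_of_lt hc]
  · rw [h' c hc, clausewise_of_ge hc]

/-- The column of the variable `x` in the coefficient matrix of `φ`. -/
def column (φ : XorCNF) (x : ℕ) : ℕ → ZMod 2 := φ.clausewise fun C => C.vars.count x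

/-- The signature of the zero assignment, as a vector. -/
def base (φ : XorCNF) : ℕ → ZMod 2 := φ.clausewise fun C => 1 + C.rhs

/-- The left-hand sides of the clauses as linear forms in the assignment. -/
def lhs (φ : XorCNF) : (ℕ → ZMod 2) →ₗ[ZMod 2] (ℕ → ZMod 2) where
  toFun a := φ.clausewise fun C => (C.vars.map a).sum
  map_add' a b := .symm <| clausewise_ext
    (fun c hc => by
      simp only [clausewise_of_lt hc, Pi.add_apply]
      exact List.sum_map_add.symm)
    (fun c hc => by simp [clausewise_of_ge hc])
  map_smul' r a := .symm <| clausewise_ext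
    (fun c hc => by
      simp only [clausewise_of_lt hc, Pi.smul_apply, RingHom.id_apply, smul_eq_mul]
      exact (List.sum_map_mul_left φ[c].vars a r).symm)
    (fun c hc => by simp [clausewise_of_ge hc])

lemma lhs_apply (φ : XorCNF) (a : ℕ → ZMod 2) :
    φ.lhs a = φ.clausewise fun C => (C.vars.map a).sum := rfl

lemma lhs_single (φ : XorCNF) (x : ℕ) : φ.lhs (Pi.single x 1) = φ.column x := by
  rw [lhs_apply, column]
  congr 1
  funext C
  rw [Finset.sum_list_map_count]
  simpa [Pi.single_apply] using fun hx => by rw [List.count_eq_zero_of_not_mem hx, Nat.cast_zero]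

lemma mem_encode {φ : XorCNF} {C : XorClause} (hC : C ∈ φ) {x : ℕ} (hx : x ∈ C.vars) :
    x ∈ φ.encode :=
  .tail _ (List.mem_flatMap.2 ⟨C, hC, .tail _ (.tail _ hx)⟩)

lemma lhs_eq_sum (φ : XorCNF) (a : ℕ → ZMod 2) :
    φ.lhs a = ∑ x ∈ φ.encode.toFinset, a x • φ.column x := by
  refine .symm (clausewise_ext (fun c hc => ?_) fun c hc => ?_)
  · rw [Finset.sum_list_map_count, Finset.sum_apply]
    refine (Finset.sum_subset_zero_on_sdiff (fun x hx => ?_) (fun x hx => ?_) fun x _ => ?_).symm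
    · exact List.mem_toFinset.2 (mem_encode (φ.getElem_mem hc) (List.mem_toFinset.1 hx))
    · have hx' : x ∉ φ[c].vars := fun h => (Finset.mem_sdiff.1 hx).2 (List.mem_toFinset.2 h)
      simp [column, clausewise_of_lt hc, List.count_eq_zero_of_not_mem hx']
    · simp [column, clausewise_of_lt hc, mul_comm]
  · simp [column, clausewise_of_ge hc]

/-- Numbers in the input that are not variables have the column 0, so they do no harm. -/
lemma range_lhs (φ : XorCNF) :
    LinearMap.range φ.lhs = Submodule.span (ZMod 2) (φ.column '' {x | x ∈ φ.encode}) := by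
  apply le_antisymm
  · rintro _ ⟨a, rfl⟩
    rw [lhs_eq_sum]
    exact Submodule.sum_smul_mem _ _ fun x hx =>
      Submodule.subset_span ⟨x, List.mem_toFinset.1 hx, rfl⟩
  · rw [Submodule.span_le]
    rintro _ ⟨x, -, rfl⟩
    exact ⟨_, φ.lhs_single x⟩

/-- The first `m` entries of a vector as a sequence of bits. -/
def bits (m : ℕ) (u : ℕ → ZMod 2) : List Bool := (List.range m).map fun j => decide (u j ≠ 0)

lemma signature_eq_bits (φ : XorCNF) (a : ℕ → ZMod 2) :
    φ.signature a = bits φ.length (φ.base + φ.lhs a) := by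
  refine List.ext_getElem (by simp [signature, bits]) fun c h _ => ?_
  have hc : c < φ.length := by simpa [signature] using h
  simp only [signature, bits, List.getElem_map, List.getElem_range, Pi.add_apply, base, lhs_apply,
    clausewise_of_lt hc, XorClause.Sat]
  have hiff : ∀ u v : ZMod 2, u = v ↔ 1 + v + u ≠ 0 := by decide
  exact decide_eq_decide.2 (hiff _ _)

lemma bits_base_add_injOn (φ : XorCNF) :
    Set.InjOn (fun u => bits φ.length (φ.base + u)) (LinearMap.range φ.lhs) := by
  rintro _ ⟨a, rfl⟩ _ ⟨b, rfl⟩ h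
  refine clausewise_ext (fun c hc => ?_) fun c hc => clausewise_of_ge hc _
  have hbit := List.map_inj_left.1 h c (List.mem_range.2 hc)
  have hinj : ∀ u v w : ZMod 2, decide (u + v ≠ 0) = decide (u + w ≠ 0) → v = w := by decide
  rw [hinj _ _ _ hbit, lhs_apply, clausewise_of_lt hc]

lemma bijOn_bits (φ : XorCNF) :
    Set.BijOn (fun u => bits φ.length (φ.base + u))
      (Submodule.span (ZMod 2) (φ.column '' {x | x ∈ φ.encode})) φ.signatures := by
  rw [← range_lhs]
  convert φ.bits_base_add_injOn.bijOn_image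
  rw [signatures, LinearMap.coe_range, ← Set.range_comp]
  exact congrArg Set.range (funext φ.signature_eq_bits)

/-! ### Layout of the input -/

/-- The position of clause number `c` in the input. -/
def offset (φ : XorCNF) (c : ℕ) : ℕ := 1 + ((φ.take c).flatMap XorClause.encode).length

lemma offset_zero (φ : XorCNF) : φ.offset 0 = 1 := rfl

lemma offset_length (φ : XorCNF) : φ.offset φ.length = φ.encode.length := by
  simp [offset, encode, add_comm]

lemma offset_succ {φ : XorCNF} {c : ℕ} (hc : c < φ.length) :
    φ.offset (c + 1) = φ.offset c + (2 + φ[c].vars.length) := by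
  simp only [offset, List.take_succ_eq_append_getElem hc, List.flatMap_append, List.length_append,
    List.flatMap_singleton, XorClause.encode, List.length_cons]
  omega

lemma encode_getD_offset_add {φ : XorCNF} {c i : ℕ} (hc : c < φ.length)
    (hi : i < φ[c].encode.length) :
    φ.encode.getD (φ.offset c + i) 0 = φ[c].encode.getD i 0 := by
  have hsplit : φ.encode = (φ.length :: (φ.take c).flatMap XorClause.encode) ++
      (φ[c].encode ++ (φ.drop (c + 1)).flatMap XorClause.encode) := by
    rw [List.cons_append, ← List.flatMap_cons, List.getElem_cons_drop, ← List.flatMap_append,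
      List.take_append_drop, encode]
  have hoffset :
      φ.offset c = (φ.length :: (φ.take c).flatMap XorClause.encode).length := by
    rw [offset, List.length_cons, add_comm]
  rw [hsplit, hoffset, List.getD_append_right _ _ _ _ (Nat.le_add_right _ _),
    Nat.add_sub_cancel_left, List.getD_append _ _ _ _ hi]

lemma encode_getD_rhs {φ : XorCNF} {c : ℕ} (hc : c < φ.length) :
    φ.encode.getD (φ.offset c) 0 = φ[c].rhs.val :=
  encode_getD_offset_add (i := 0) hc (by simp [XorClause.encode])

lemma encode_getD_length {φ : XorCNF} {c : ℕ} (hc : c < φ.length) :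
    φ.encode.getD (φ.offset c + 1) 0 = φ[c].vars.length :=
  encode_getD_offset_add (i := 1) hc (by simp [XorClause.encode])

lemma encode_getD_vars {φ : XorCNF} {c j : ℕ} (hc : c < φ.length) (hj : j < φ[c].vars.length) :
    φ.encode.getD (φ.offset c + (j + 2)) 0 = φ[c].vars[j] := by
  rw [encode_getD_offset_add hc (by simpa [XorClause.encode] using hj)]
  simp [XorClause.encode, hj]

lemma length_le_length_encode (φ : XorCNF) : φ.length ≤ φ.encode.length := by
  rw [encode, List.length_cons, List.length_flatMap]
  refine Nat.le_succ_of_le ?_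
  simpa using List.length_le_sum_of_one_le (φ.map fun C => C.encode.length)
    (by simp [XorClause.encode])

lemma length_vars_le {φ : XorCNF} {C : XorClause} (hC : C ∈ φ) :
    C.vars.length ≤ φ.encode.length :=
  List.Sublist.length_le <| calc
    C.vars.Sublist C.encode := (List.sublist_cons_self _ _).trans (List.sublist_cons_self _ _)
    C.encode.Sublist φ.encode :=
      (List.sublist_flatten_of_mem (List.mem_map_of_mem hC)).trans (List.sublist_cons_self _ _)

/-! ### The machine -/

open RAM

/-- The names of the machine's arrays end in `A`, those of its scalar variables in `R`; array `0`
holds the input. -/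
abbrev inputA : ℕ := 0
abbrev baseA : ℕ := 1
abbrev vectorA : ℕ := 2
abbrev basisA : ℕ := 3
abbrev digitA : ℕ := 4
abbrev variableR : ℕ := 5
abbrev positionR : ℕ := 6
abbrev clauseR : ℕ := 7
abbrev entryR : ℕ := 8
abbrev lengthR : ℕ := 9
abbrev cellR : ℕ := 10
abbrev rowR : ℕ := 11
abbrev startR : ℕ := 12
abbrev carryR : ℕ := 13

/-- The distance of two numbers; for bits, their sum modulo 2. -/
def absDiff (e f : Expr) : Expr := .add (.sub e f) (.sub f e)

/-- Run `P` for each clause, with its number and its position in the input in registers. -/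
def forClauses (P : Prog) : Prog :=
  .walk clauseR positionR (.lit 1) (.var inputA)
    (.add (.var positionR) (.add (.lit 2) (.cell inputA (.add (.var positionR) (.lit 1))))) P

/-- Run `P` for each row of the echelon form, with its number and the index of its first entry in
registers. -/
def forRows (P : Prog) : Prog :=
  .walk rowR startR (.lit 0) (.var inputA) (.add (.var startR) (.var inputA)) P

/-- The cell of the echelon form that holds entry number `e` of the current row. -/
def rowCell (e : Expr) : Expr := .cell basisA (.add (.var startR) e)

/-- Writes the signature of the zero assignment to `baseA` and leaves the length of the input in
`positionR`. -/
def loadBase : Prog :=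
  forClauses (.store baseA (.var clauseR) (.sub (.lit 1) (.cell inputA (.var positionR))))

/-- Adds to entry `clauseR` of `vectorA` the coefficient of the variable `variableR` in this clause,
which is the parity of its number of occurrences. -/
def addColumnEntry : Prog :=
  .forLoop entryR (.cell inputA (.add (.var positionR) (.lit 1)))
    (.store vectorA (.var clauseR) (absDiff (.cell vectorA (.var clauseR))
      (.sub (.lit 1) (absDiff
        (.cell inputA (.add (.var positionR) (.add (.var entryR) (.lit 2))))
        (.var variableR)))))

/-- Adds the coefficient column of the variable `variableR` to `vectorA`. -/
def addColumn : Prog := forClauses addColumnEntry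

/-- Adds the current row of the echelon form to the vector in array `a`. -/
def addRow (a : ℕ) : Prog :=
  .forLoop entryR (.var inputA)
    (.store a (.var entryR) (absDiff (.cell a (.var entryR)) (rowCell (.var entryR))))

/-- Makes `vectorA` the current row of the echelon form. -/
def copyRow : Prog :=
  .forLoop entryR (.var inputA)
    (.store basisA (.add (.var startR) (.var entryR)) (.cell vectorA (.var entryR)))

/-- One step of Gaussian elimination: clears entry `rowR` of `vectorA` by adding the current row. If
this row is still free, `vectorA` itself is put there first, and is thereby cleared altogether. -/
def eliminateEntry : Prog :=
  .ite (.cell vectorA (.var rowR))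
    (.seq (.ite (rowCell (.var rowR)) .skip copyRow) (addRow vectorA)) .skip

/-- Extends the span of the echelon form by the vector in `vectorA`, which is cleared. -/
def insertVector : Prog := forRows eliminateEntry

/-- Clears the scalar variables of `round` that can hold numbers other than bits, so that memory
does not accumulate over the rounds. -/
def reset : Prog :=
  .seq (.assign entryR (.lit 0)) (.seq (.assign rowR (.lit 0)) (.assign startR (.lit 0)))

/-- Extends the span of the echelon form by the column of the variable that number `cellR` of the
input stands for. -/
def insertColumn : Prog :=
  .seq (.assign variableR (.cell inputA (.var cellR))) (.seq addColumn insertVector)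

/-- Gaussian elimination. Every number of the input is treated as a variable, which saves parsing it
and only adds columns that are zero or occur anyway. -/
def insertColumns : Prog := .forLoop cellR (.var lengthR) insertColumn

/-- The preparation before the first output: the signature of the zero assignment and the echelon
form. -/
def prepare : Prog :=
  .seq loadBase (.seq (.assign lengthR (.var positionR)) (.seq insertColumns reset))

/-- Adds `carryR` to digit `rowR` of the counter and keeps `baseA` up to date. There is a digit only
if the diagonal entry of the current row is 1; the old digit is the new carry. -/
def incrementDigit : Prog :=
  .ite (.sub (rowCell (.var rowR)) (.sub (.lit 1) (.var carryR)))
    (.seq (addRow baseA) (.seq (.assign carryR (.cell digitA (.var rowR)))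
      (.store digitA (.var rowR) (.sub (.lit 1) (.cell digitA (.var rowR))))))
    .skip

/-- Increments the counter; the final carry tells whether all of its values have been used. -/
def increment : Prog := .seq (.assign carryR (.lit 1)) (forRows incrementDigit)

/-- Writes the signature in `baseA` to the output device. -/
def writeBase : Prog := .forLoop entryR (.var inputA) (.write (.cell baseA (.var entryR)))

/-- The body of the main loop, which outputs one signature. -/
def round : Prog := .seq writeBase (.seq .emit (.seq increment reset))

/-- Array `a` holds the bits of the vector `u`. -/
def Holds (s : State) (a : ℕ) (u : ℕ → ZMod 2) : Prop := ∀ j, s.mem (a, j) = (u j).val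

/-- The rows of length `m` of the matrix `E` are held one after the other in `basisA`. -/
def HoldsRows (m : ℕ) (s : State) (E : ℕ → ℕ → ZMod 2) : Prop :=
  ∀ i, ∀ j < m, s.mem (basisA, i * m + j) = (E i j).val

/-- Array `0` holds the encoding of `φ`. -/
def HasInput (φ : XorCNF) (s : State) : Prop := ∀ i, s.mem (inputA, i) = φ.encode.getD i 0

/-- The state in which a vector is being inserted into an echelon form and its entries before `k`
have been cleared; see `Elimination` for `W`. -/
def Eliminating (m k : ℕ) (W : Submodule (ZMod 2) (ℕ → ZMod 2)) (s : State) : Prop :=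
  ∃ E u, HoldsRows m s E ∧ Holds s vectorA u ∧ Elimination m k W E u

/-- The state after `K` rounds of the main loop, if `s₀` is the state after the preparation. -/
structure Enumerated (φ : XorCNF) (E : ℕ → ℕ → ZMod 2) (s₀ : State) (K : ℕ) (s : State) :
    Prop where
  input : HasInput φ s
  rows : HoldsRows φ.length s E
  base : Holds s baseA (φ.base + combination φ.length E K)
  digits : Holds s digitA (digit (fun j => E j j ≠ 0) K)
  carry : s.mem (carryR, 0) = if K = 2 ^ rank φ.length E then 1 else 0
  scalars : ∀ a ∈ [entryR, rowR, startR], s.mem (a, 0) = 0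
  other : ∀ a i, round.writes a i = false → s.mem (a, i) = s₀.mem (a, i)
  buf : s.buf = []
  out : s.out =
    (List.range K).map fun k => bits φ.length (φ.base + combination φ.length E k)

variable {φ : XorCNF} {s s' : State} {P : Prog} {a b i j k m n v x N : ℕ} {e f : Expr} {M : Mem}
  {c : ZMod 2} {u w : ℕ → ZMod 2} {E : ℕ → ℕ → ZMod 2}

lemma Holds.frame (h : Holds s a u) (hF : Frame P s s') (hP : ∀ j, P.writes a j = false) :
    Holds s' a u := fun j => (hF.mem a j (hP j)).trans (h j)

lemma Holds.set_of_ne (h : Holds s a u) (hab : a ≠ b) : Holds (s.set b i v) a u := fun j => by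
  rw [State.set_mem, if_neg fun h => hab h.1, h j]

lemma Holds.add_single (h : Holds s a u) (hv : v = (u i + c).val) :
    Holds (s.set a i v) a (u + Pi.single i c) := fun j => by
  rcases eq_or_ne j i with rfl | hj <;> simp [*, h j]

lemma HoldsRows.frame (h : HoldsRows m s E) (hF : Frame P s s')
    (hP : ∀ j, P.writes basisA j = false) : HoldsRows m s' E :=
  fun i j hj => (hF.mem _ _ (hP _)).trans (h i j hj)

lemma HoldsRows.set_of_ne (h : HoldsRows m s E) (ha : basisA ≠ a) :
    HoldsRows m (s.set a k v) E := fun i j hj => by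
  rw [State.set_mem, if_neg fun h => ha h.1, h i j hj]

lemma HoldsRows.add_single (h : HoldsRows m s E) (hj : j < m) (hv : v = (E k j + c).val) :
    HoldsRows m (s.set basisA (k * m + j) v) (E + Pi.single k (Pi.single j c)) := by
  have hinj : ∀ i, ∀ l < m, i * m + l = k * m + j ↔ i = k ∧ l = j := fun i l hl => by
    refine ⟨fun h => ?_, by rintro ⟨rfl, rfl⟩; rfl⟩
    have hm : 0 < m := by omega
    have hdiv := congrArg (· / m) h
    have hmod := congrArg (· % m) h
    simpa [Nat.add_comm (_ * m), Nat.add_mul_div_right _ _ hm, Nat.div_eq_of_lt hl,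
      Nat.div_eq_of_lt hj, Nat.mod_eq_of_lt hl, Nat.mod_eq_of_lt hj, hm] using And.intro hdiv hmod
  intro i l hl
  rw [State.set_mem]
  simp only [hinj i l hl, true_and]
  rcases eq_or_ne i k with rfl | hi <;> rcases eq_or_ne l j with rfl | hlj <;> simp [*, h i l hl]

lemma HasInput.frame (h : HasInput φ s) (hF : Frame P s s')
    (hP : ∀ j, P.writes inputA j = false) : HasInput φ s' :=
  fun j => (hF.mem _ j (hP j)).trans (h j)

lemma HasInput.set_of_ne (h : HasInput φ s) (ha : inputA ≠ a) :
    HasInput φ (s.set a i v) := fun j => by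
  rw [State.set_mem, if_neg fun h => ha h.1, h j]

lemma HasInput.length (h : HasInput φ s) : s.mem (inputA, 0) = φ.length := h 0

lemma eval_absDiff (he : e.eval M = c.val) {d : ZMod 2} (hf : f.eval M = d.val) :
    (absDiff e f).eval M = (c + d).val := by
  have hval : ∀ c d : ZMod 2, c.val - d.val + (d.val - c.val) = (c + d).val := by decide
  rw [← hval, ← he, ← hf]
  rfl

lemma eval_one_sub_absDiff (he : e.eval M = a) (hf : f.eval M = b) :
    (Expr.sub (.lit 1) (absDiff e f)).eval M = (if a = b then 1 else 0 : ZMod 2).val := by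
  subst he hf
  simp only [absDiff, Expr.eval]
  split_ifs <;> simp only [ZMod.val_one, ZMod.val_zero] <;> omega

lemma indicator_Iio_zero {R : Type*} [Zero R] (f : ℕ → R) : (Set.Iio 0).indicator f = 0 := by
  funext j
  simp

lemma indicator_Iio_succ {R : Type*} [AddZeroClass R] (f : ℕ → R) (k : ℕ) :
    (Set.Iio (k + 1)).indicator f = (Set.Iio k).indicator f + Pi.single k (f k) := by
  funext j
  rcases eq_or_ne j k with rfl | hj
  · simp
  · simp [Set.indicator, hj, hj.le_iff_lt]

lemma wp_forClauses {Q : State → Prop} (I : ℕ → State → Prop) (hN : φ.length ≤ N)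
    (hs : HasInput φ s) (hP : ∀ j, P.writes inputA j = false)
    (hclause : P.writes clauseR 0 = false) (hposition : P.writes positionR 0 = false)
    (hset : ∀ c s, I c s → ∀ a v, a ∈ [clauseR, positionR] → I c (s.set a 0 v)) (h₀ : I 0 s)
    (hstep : ∀ c (_ : c < φ.length), ∀ s', HasInput φ s' → Frame (forClauses P) s s' →
      s'.mem (clauseR, 0) = c → s'.mem (positionR, 0) = φ.offset c → I c s' →
      WP N P (I (c + 1)) s')
    (hQ : ∀ s', s'.mem (positionR, 0) = φ.encode.length → I φ.length s' → Q s') :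
    WP N (forClauses P) Q s := by
  have hinput : ∀ s', Frame (forClauses P) s s' → HasInput φ s' := fun s' hF =>
    hs.frame hF (by simp [forClauses, Prog.walk, Prog.forLoop, Prog.writes, hP])
  refine WP.walk φ.offset I hN (by decide) hclause hposition
    (fun c s v h => ⟨hset c s h _ v (by simp), hset c s h _ v (by simp)⟩) h₀ φ.offset_zero.symm
    (fun s' hF => (hinput s' hF).length) (fun c hc s' hF hs' => ?_)
    (fun c hc s' hF => hstep c hc s' (hinput s' hF) hF)
    fun s' _ hs' => hQ s' (hs'.trans φ.offset_length)
  simp only [Expr.eval, hs', hinput s' hF _, encode_getD_length hc, offset_succ hc]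

lemma wp_forRows {Q : State → Prop} (I : ℕ → State → Prop) (hN : m ≤ N)
    (hs : s.mem (inputA, 0) = m) (hP : P.writes inputA 0 = false)
    (hrow : P.writes rowR 0 = false) (hstart : P.writes startR 0 = false)
    (hset : ∀ k s, I k s → ∀ a v, a ∈ [rowR, startR] → I k (s.set a 0 v)) (h₀ : I 0 s)
    (hstep : ∀ k < m, ∀ s', Frame (forRows P) s s' → s'.mem (rowR, 0) = k →
      s'.mem (startR, 0) = k * m → I k s' → WP N P (I (k + 1)) s')
    (hQ : ∀ s', Frame (forRows P) s s' → I m s' → Q s') :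
    WP N (forRows P) Q s := by
  have hlength : ∀ s', Frame (forRows P) s s' → s'.mem (inputA, 0) = m := fun s' hF =>
    (hF.mem _ _ (by simp [forRows, Prog.walk, Prog.forLoop, Prog.writes, hP])).trans hs
  refine WP.walk (· * m) I hN (by decide) hrow hstart
    (fun c s v h => ⟨hset c s h _ v (by simp), hset c s h _ v (by simp)⟩) h₀ (by simp [Expr.eval])
    hlength (fun k _ s' hF hs' => ?_) hstep fun s' hF _ => hQ s' hF
  simp only [Expr.eval, hs', hlength s' hF, Nat.succ_mul]

lemma wp_loadBase (hN : φ.length ≤ N) (hs : HasInput φ s) (h₀ : Holds s baseA 0) :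
    WP N loadBase (fun s' => s'.mem (positionR, 0) = φ.encode.length ∧ Holds s' baseA φ.base)
      s := by
  refine wp_forClauses (fun c s' => Holds s' baseA ((Set.Iio c).indicator φ.base)) hN hs
    (fun _ => rfl) rfl rfl (fun c s h a v ha => h.set_of_ne (by rintro rfl; simp at ha))
    (by rwa [indicator_Iio_zero]) (fun c hc s' hs' _ hclause hposition h => WP.store ?_)
    fun s' hposition h => ⟨hposition, ?_⟩
  · have hnot : ∀ r : ZMod 2, 1 - r.val = (0 + (1 + r)).val := by decide
    rw [indicator_Iio_succ]
    simp only [Expr.eval, hclause]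
    refine h.add_single ?_
    rw [hposition, hs', encode_getD_rhs hc, Set.indicator_of_notMem Set.self_notMem_Iio, base,
      clausewise_of_lt hc, hnot]
  · rwa [Set.indicator_eq_self.2 (show Function.support φ.base ⊆ _ from
      φ.support_clausewise_subset _)] at h

lemma wp_addColumnEntry (hN : φ.encode.length ≤ N) (hs : HasInput φ s) (hc : k < φ.length)
    (hx : s.mem (variableR, 0) = x) (hclause : s.mem (clauseR, 0) = k)
    (hposition : s.mem (positionR, 0) = φ.offset k) (hu : Holds s vectorA u) :
    WP N addColumnEntry (fun s' => Holds s' vectorA (u + Pi.single k (φ.column x k))) s := by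
  let partialCount (j : ℕ) : ZMod 2 := (φ[k].vars.take j).count x
  refine WP.forLoop (n := φ[k].vars.length)
    (fun j s' => Holds s' vectorA (u + Pi.single k (partialCount j)))
    ((length_vars_le (φ.getElem_mem hc)).trans hN) rfl (fun j s v h => h.set_of_ne (by decide))
    (by simpa [partialCount] using hu) (fun s' hF => ?_)
    (fun j hj s' hF hentry h => WP.store ?_) fun s' _ h => ?_
  · simp only [Expr.eval]
    rw [hF.mem positionR _ rfl, hposition, hs.frame hF (fun _ => rfl), encode_getD_length hc]
  · have hsucc : partialCount (j + 1) = partialCount j + if φ[k].vars[j] = x then 1 else 0 := by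
      simp only [partialCount, List.take_succ_eq_append_getElem hj, List.count_append,
        List.count_singleton, Nat.cast_add, Nat.cast_ite, Nat.cast_one, Nat.cast_zero, beq_iff_eq]
    have hindex : s'.mem (clauseR, 0) = k := (hF.mem _ _ rfl).trans hclause
    rw [hsucc, Pi.single_add, ← add_assoc]
    simp only [Expr.eval, hindex]
    refine h.add_single (eval_absDiff ?_ ?_)
    · simp only [Expr.eval, hindex, h k]
    · refine eval_one_sub_absDiff ?_ ((hF.mem variableR _ rfl).trans hx)
      simp only [Expr.eval]
      rw [hF.mem positionR _ rfl, hposition, hs.frame hF (fun _ => rfl), hentry,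
        encode_getD_vars hc hj]
  · rwa [column, clausewise_of_lt hc, ← List.take_length (l := φ[k].vars)]

lemma wp_addColumn (hN : φ.encode.length ≤ N) (hs : HasInput φ s) (hx : s.mem (variableR, 0) = x)
    (h₀ : Holds s vectorA 0) : WP N addColumn (fun s' => Holds s' vectorA (φ.column x)) s := by
  refine wp_forClauses (fun c s' => Holds s' vectorA ((Set.Iio c).indicator (φ.column x)))
    (φ.length_le_length_encode.trans hN) hs (fun _ => rfl) rfl rfl
    (fun c s h a v ha => h.set_of_ne (by rintro rfl; simp at ha)) (by rwa [indicator_Iio_zero])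
    (fun c hc s' hs' hF hclause hposition h => ?_) fun s' _ h => ?_
  · rw [indicator_Iio_succ]
    exact wp_addColumnEntry hN hs' hc ((hF.mem _ _ rfl).trans hx) hclause hposition h
  · rwa [Set.indicator_eq_self.2 (show Function.support (φ.column x) ⊆ _ from
      φ.support_clausewise_subset _)] at h

lemma wp_addRow (hN : m ≤ N) (ha : a ∉ [inputA, basisA, entryR, startR])
    (hs : s.mem (inputA, 0) = m) (hw : ∀ j < m, s.mem (basisA, s.mem (startR, 0) + j) = (w j).val)
    (hwm : Function.support w ⊆ Set.Iio m) (hu : Holds s a u) :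
    WP N (addRow a) (fun s' => Holds s' a (u + w)) s := by
  simp only [List.mem_cons, List.not_mem_nil, not_or, or_false] at ha
  obtain ⟨hinput, hbasis, hentry, hstart⟩ := ha
  have hframe : ∀ b i, b ≠ a → b ≠ entryR → (addRow a).writes b i = false := fun b i h h' => by
    simp [addRow, Prog.forLoop, Prog.writes, h, h']
  refine WP.forLoop (fun j s' => Holds s' a (u + (Set.Iio j).indicator w)) hN
    (by simp [Prog.writes, Ne.symm hentry]) (fun j s v h => h.set_of_ne hentry)
    (by rwa [indicator_Iio_zero, add_zero])
    (fun s' hF => (hF.mem _ _ (hframe _ _ (Ne.symm hinput) (by decide))).trans hs)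
    (fun j hj s' hF hj' h => WP.store ?_) fun s' _ h => ?_
  · rw [indicator_Iio_succ, ← add_assoc]
    simp only [Expr.eval, hj']
    refine h.add_single (eval_absDiff ?_ ?_)
    · simp only [Expr.eval, hj', h j]
    · simp only [rowCell, Expr.eval, hj']
      rw [hF.mem startR _ (hframe _ _ (Ne.symm hstart) (by decide)),
        hF.mem basisA _ (hframe _ _ (Ne.symm hbasis) (by decide)), hw j hj]
  · rwa [Set.indicator_eq_self.2 hwm] at h

lemma wp_copyRow (hN : m ≤ N) (hs : s.mem (inputA, 0) = m) (hk : s.mem (startR, 0) = k * m)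
    (hE : HoldsRows m s E) (hEk : E k = 0) (hu : Holds s vectorA u)
    (hum : Function.support u ⊆ Set.Iio m) :
    WP N copyRow (fun s' => HoldsRows m s' (Function.update E k u)) s := by
  refine WP.forLoop (fun j s' => HoldsRows m s' (E + Pi.single k ((Set.Iio j).indicator u))) hN rfl
    (fun j s v h => h.set_of_ne (by decide)) (by rwa [indicator_Iio_zero, Pi.single_zero, add_zero])
    (fun s' hF => (hF.mem _ _ rfl).trans hs) (fun j hj s' hF hentry h => WP.store ?_)
    fun s' _ h => ?_
  · rw [indicator_Iio_succ, Pi.single_add, ← add_assoc]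
    simp only [Expr.eval, hentry, hF.mem startR 0 rfl, hk]
    refine h.add_single hj ?_
    simp [hEk, hu.frame hF (fun _ => rfl) j]
  · rw [Set.indicator_eq_self.2 hum] at h
    rwa [Pi.update_eq_sub_add_single, hEk, Pi.single_zero, sub_zero]

lemma wp_eliminateEntry {W : Submodule (ZMod 2) (ℕ → ZMod 2)} (hN : m ≤ N)
    (hs : s.mem (inputA, 0) = m) (hk : k < m) (hrow : s.mem (rowR, 0) = k)
    (hstart : s.mem (startR, 0) = k * m) (h : Eliminating m k W s) :
    WP N eliminateEntry (Eliminating m (k + 1) W) s := by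
  obtain ⟨E, u, hE, hu, hEu⟩ := h
  have huk : (Expr.cell vectorA (.var rowR)).eval s.mem = (u k).val := by
    simp only [Expr.eval, hrow, hu k]
  have hEk : (rowCell (.var rowR)).eval s.mem = (E k k).val := by
    simp only [rowCell, Expr.eval, hrow, hstart, hE k k hk]
  refine WP.ite (fun h₁ => WP.seq ?_) fun h₀ => WP.skip ⟨E, u, hE, hu, hEu.skip ?_⟩
  · rw [huk, ZMod.val_ne_zero] at h₁
    refine WP.mono (Q := fun s' => ∃ E, HoldsRows m s' E ∧ Holds s' vectorA u ∧
      Elimination m k W E u ∧ E k k ≠ 0) (WP.ite (fun h => ?_) fun h => ?_)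
      fun s' hF ⟨E, hE, hu, hEu, hEk⟩ => ?_
    · rw [hEk, ZMod.val_ne_zero] at h
      exact WP.skip ⟨E, hE, hu, hEu, h⟩
    · rw [hEk, ZMod.val_eq_zero] at h
      refine (wp_copyRow hN hs hstart hE (hEu.echelon.eq_zero k h) hu fun j hj =>
        (hEu.support_subset hj).2).mono fun s' hF hE' => ?_
      exact ⟨_, hE', hu.frame hF fun _ => rfl, hEu.place h₁ h, by simpa using h₁⟩
    · refine (wp_addRow hN (by decide) ((hF.mem _ _ rfl).trans hs) (fun j hj => ?_)
        (fun j hj => (hEu.echelon.support_subset k hj).2) hu).mono fun s'' hF' hu' =>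
        ⟨E, u + E k, hE.frame hF' fun _ => rfl, hu', hEu.reduce h₁ hEk⟩
      rw [hF.mem startR _ rfl, hstart, hE k j hj]
  · rwa [huk, ZMod.val_eq_zero] at h₀

lemma wp_insertVector {W : Submodule (ZMod 2) (ℕ → ZMod 2)} (hN : m ≤ N)
    (hs : s.mem (inputA, 0) = m) (h : Eliminating m 0 W s) :
    WP N insertVector (Eliminating m m W) s :=
  wp_forRows (Eliminating m · W) hN hs rfl rfl rfl
    (fun k s ⟨E, u, hE, hu, hEu⟩ a v ha => ⟨E, u, hE.set_of_ne (by rintro rfl; simp at ha),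
      hu.set_of_ne (by rintro rfl; simp at ha), hEu⟩) h
    (fun k hk s' hF hrow hstart =>
      wp_eliminateEntry hN ((hF.mem _ _ rfl).trans hs) hk hrow hstart)
    fun _ _ h => h

lemma wp_reset : WP N reset (fun s' => ∀ a ∈ [entryR, rowR, startR], s'.mem (a, 0) = 0) s :=
  .seq <| .assign <| .seq <| .assign <| .assign <| by simp [Expr.eval]

lemma wp_insertColumn (hN : φ.encode.length ≤ N) (hs : HasInput φ s) (hi : i < φ.encode.length)
    (hcell : s.mem (cellR, 0) = i)
    (h : Eliminating φ.length φ.length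
      (Submodule.span _ (φ.column '' {x | x ∈ φ.encode.take i})) s) :
    WP N insertColumn (Eliminating φ.length φ.length
      (Submodule.span _ (φ.column '' {x | x ∈ φ.encode.take (i + 1)}))) s := by
  obtain ⟨E, u, hE, hu, hEu⟩ := h
  obtain rfl := hEu.eq_zero
  refine WP.seq <| .assign <| .seq <| (wp_addColumn hN (hs.set_of_ne (by decide))
    (x := φ.encode[i]) ?_ (hu.set_of_ne (by decide))).mono fun s' hF hu' =>
    wp_insertVector (φ.length_le_length_encode.trans hN)
      ((hF.mem _ _ rfl).trans (hs.set_of_ne (by decide)).length)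
      ⟨E, _, (hE.set_of_ne (by decide)).frame hF fun _ => rfl, hu', hEu.echelon, fun c hc =>
        ⟨c.zero_le, φ.support_clausewise_subset _ hc⟩, ?_⟩
  · simp [Expr.eval, hcell, hs i, hi]
  · have htake : {x | x ∈ φ.encode.take (i + 1)} =
        insert φ.encode[i] {x | x ∈ φ.encode.take i} := by
      ext x
      simp only [List.take_succ_eq_append_getElem hi, List.mem_append, List.mem_singleton,
        Set.mem_ofPred_eq, Set.mem_insert_iff, or_comm]
    rw [htake, Set.image_insert_eq, Submodule.span_insert, Submodule.span_insert, hEu.span_range]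

lemma wp_insertColumns (hN : φ.encode.length ≤ N) (hs : HasInput φ s)
    (hlength : s.mem (lengthR, 0) = φ.encode.length) (hu : Holds s vectorA 0)
    (hE : Holds s basisA 0) :
    WP N insertColumns (fun s' => ∃ E, HoldsRows φ.length s' E ∧ Echelon φ.length E ∧
      Submodule.span (ZMod 2) (Set.range E) =
        Submodule.span (ZMod 2) (φ.column '' {x | x ∈ φ.encode})) s := by
  refine WP.forLoop (fun i => Eliminating φ.length φ.length
    (Submodule.span _ (φ.column '' {x | x ∈ φ.encode.take i}))) hN rfl
    (fun i s v ⟨E, u, hE, hu, hEu⟩ => ⟨E, u, hE.set_of_ne (by decide),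
      hu.set_of_ne (by decide), hEu⟩)
    ⟨0, 0, fun i j _ => hE _, hu, .zero _, by simp, by simp⟩
    (fun s' hF => (hF.mem _ _ rfl).trans hlength)
    (fun i hi s' hF hi' => wp_insertColumn hN (hs.frame hF fun _ => rfl) hi hi')
    fun s' _ ⟨E, u, hE, _, hEu⟩ => ⟨E, hE, hEu.echelon, ?_⟩
  simpa using hEu.span_range

lemma wp_prepare (hN : φ.encode.length ≤ N) :
    WP N prepare (fun s => ∃ E, Echelon φ.length E ∧
      Submodule.span (ZMod 2) (Set.range E) =
        Submodule.span (ZMod 2) (φ.column '' {x | x ∈ φ.encode}) ∧ Enumerated φ E s 0 s)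
      ⟨inputMem φ.encode, [], []⟩ := by
  have hzero : ∀ a, a ≠ 0 → Holds ⟨inputMem φ.encode, [], []⟩ a 0 := fun a ha j => by
    simp [inputMem_apply, ha]
  have hinput : HasInput φ ⟨inputMem φ.encode, [], []⟩ := fun j => by simp [inputMem_apply]
  refine WP.mono (Q := fun s => Holds s baseA φ.base ∧ (∃ E, HoldsRows φ.length s E ∧
    Echelon φ.length E ∧ Submodule.span (ZMod 2) (Set.range E) =
        Submodule.span (ZMod 2) (φ.column '' {x | x ∈ φ.encode})) ∧
    ∀ a ∈ [entryR, rowR, startR], s.mem (a, 0) = 0) ?_ ?_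
  · refine WP.seq ((wp_loadBase (φ.length_le_length_encode.trans hN) hinput
      (hzero _ (by decide))).mono fun s hF ⟨hposition, hbase⟩ => .seq <| .assign <| .seq <|
        (wp_insertColumns hN ((hinput.frame hF fun _ => rfl).set_of_ne (by decide))
          (by simp [Expr.eval, hposition])
          (((hzero _ (by decide)).frame hF fun _ => rfl).set_of_ne (by decide))
          (((hzero _ (by decide)).frame hF fun _ => rfl).set_of_ne (by decide))).mono
        fun s' hF' ⟨E, hE, hechelon, hspan⟩ => wp_reset.mono fun s'' hF'' hreset => ?_)
    exact ⟨((hbase.set_of_ne (by decide)).frame hF' fun _ => rfl).frame hF'' fun _ => rfl,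
      ⟨E, hE.frame hF'' fun _ => rfl, hechelon, hspan⟩, hreset⟩
  · rintro s hF ⟨hbase, ⟨E, hE, hechelon, hspan⟩, hreset⟩
    exact ⟨E, hechelon, hspan, {
      input := hinput.frame hF fun _ => rfl
      rows := hE
      base := by rwa [combination_zero, add_zero]
      digits := by
        rw [digit_zero]
        exact (hzero digitA (by decide)).frame hF fun _ => rfl
      carry := by
        rw [if_neg (by positivity)]
        exact (hF.mem _ _ rfl).trans (by simp [inputMem_apply])
      scalars := hreset
      other := fun _ _ _ => rfl
      buf := hF.buf rfl
      out := hF.out rfl }⟩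

/-- The counter is being incremented from `K` to `K + 1`, and the places before `k` are done. -/
structure Incrementing (m : ℕ) (E : ℕ → ℕ → ZMod 2) (u : ℕ → ZMod 2) (K k : ℕ) (s : State) :
    Prop where
  base : Holds s baseA
    (u + combination m E K + ∑ j ∈ Finset.range k, flips (fun j => E j j ≠ 0) K j • E j)
  digits : Holds s digitA
    (digit (fun j => E j j ≠ 0) K + (Set.Iio k).indicator (flips (fun j => E j j ≠ 0) K))
  carry : s.mem (carryR, 0) = if 2 ^ rank k E ∣ K + 1 then 1 else 0

lemma Incrementing.set_of_ne (h : Incrementing m E u n k s) (ha : a ∉ [baseA, digitA, carryR]) :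
    Incrementing m E u n k (s.set a i v) := by
  simp only [List.mem_cons, List.not_mem_nil, not_or, or_false] at ha
  obtain ⟨hbase, hdigit, hcarry⟩ := ha
  refine ⟨h.base.set_of_ne (Ne.symm hbase), h.digits.set_of_ne (Ne.symm hdigit), ?_⟩
  rw [State.set_mem, if_neg fun h => hcarry h.1.symm, h.carry]

lemma Incrementing.digit (h : Incrementing m E u n k s) :
    s.mem (digitA, k) = (digit (fun j => E j j ≠ 0) n k).val := by
  rw [h.digits k, Pi.add_apply, Set.indicator_of_notMem Set.self_notMem_Iio, add_zero]

lemma Incrementing.guard (h : Incrementing m E u n k s)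
    (hdiag : (rowCell (.var rowR)).eval s.mem = (E k k).val) :
    (Expr.sub (rowCell (.var rowR)) (.sub (.lit 1) (.var carryR))).eval s.mem ≠ 0 ↔
      E k k ≠ 0 ∧ 2 ^ rank k E ∣ n + 1 := by
  have hone : ∀ c : ZMod 2, c.val - 0 ≠ 0 ↔ c ≠ 0 := by decide
  have hzero : ∀ c : ZMod 2, ¬c.val - 1 ≠ 0 := by decide
  simp only [Expr.eval] at hdiag ⊢
  rw [hdiag, h.carry]
  split_ifs with hdvd
  · simp only [hdvd, and_true, hone]
  · simp only [hdvd, and_false, hzero]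

lemma Incrementing.skip (h : Incrementing m E u n k s)
    (hk : ¬(E k k ≠ 0 ∧ 2 ^ rank k E ∣ n + 1)) : Incrementing m E u n (k + 1) s := by
  have hflip : flips (fun j => E j j ≠ 0) n k = 0 := if_neg hk
  have hnext : 2 ^ rank (k + 1) E ∣ n + 1 ↔ 2 ^ rank k E ∣ n + 1 :=
    (two_pow_count_succ_dvd_iff n k).trans
      (and_iff_left_of_imp fun hdvd hEk => absurd ⟨hEk, hdvd⟩ hk)
  refine ⟨?_, ?_, ?_⟩
  · rw [Finset.sum_range_succ, hflip, zero_smul, add_zero]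
    exact h.base
  · rw [indicator_Iio_succ, hflip, Pi.single_zero, add_zero]
    exact h.digits
  · simp only [hnext, h.carry]

lemma wp_incrementDigit (hN : m ≤ N) (hs : s.mem (inputA, 0) = m) (hE : HoldsRows m s E)
    (hechelon : Echelon m E) (hk : k < m) (hrow : s.mem (rowR, 0) = k)
    (hstart : s.mem (startR, 0) = k * m) (h : Incrementing m E u n k s) :
    WP N incrementDigit (Incrementing m E u n (k + 1)) s := by
  have hguard := h.guard (by simp only [rowCell, Expr.eval, hrow, hstart, hE k k hk])
  refine WP.ite (fun hflips => ?_) fun hskip => WP.skip (h.skip (by rwa [← hguard, not_not]))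
  obtain ⟨hEk, hdvd⟩ := hguard.1 hflips
  have hflip : flips (fun j => E j j ≠ 0) n k = 1 := if_pos ⟨hEk, hdvd⟩
  have hdigit : ∀ s', Frame (addRow baseA) s s' →
      s'.mem (digitA, k) = (digit (fun j => E j j ≠ 0) n k).val ∧ s'.mem (rowR, 0) = k :=
    fun s' hF => ⟨(hF.mem _ _ rfl).trans h.digit, (hF.mem _ _ rfl).trans hrow⟩
  refine WP.seq ((wp_addRow hN (by decide) hs (fun j hj => by rw [hstart, hE k j hj])
    (fun j hj => (hechelon.support_subset k hj).2) h.base).mono fun s' hF hbase =>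
    .seq <| .assign <| .store ⟨?_, ?_, ?_⟩)
  · rw [Finset.sum_range_succ, hflip, one_smul, ← add_assoc]
    exact (hbase.set_of_ne (by decide)).set_of_ne (by decide)
  · have hnot : ∀ c : ZMod 2, 1 - c.val = (c + 1).val := by decide
    rw [indicator_Iio_succ, hflip, ← add_assoc]
    simp only [Expr.eval, State.set_mem, hdigit s' hF]
    refine ((h.digits.frame hF fun _ => rfl).set_of_ne (by decide)).add_single ?_
    simp [hdigit s' hF, hnot]
  · have hval : ∀ c : ZMod 2, c.val = if c = 1 then 1 else 0 := by decide
    have hnext : 2 ^ rank (k + 1) E ∣ n + 1 ↔ digit (fun j => E j j ≠ 0) n k = 1 :=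
      (two_pow_count_succ_dvd_iff n k).trans
        ((and_iff_right hdvd).trans ⟨fun h => h hEk, fun h _ => h⟩)
    simp [Expr.eval, hdigit s' hF, hval, hnext]

lemma wp_increment (hN : m ≤ N) (hs : s.mem (inputA, 0) = m) (hE : HoldsRows m s E)
    (hechelon : Echelon m E) (hn : n < 2 ^ rank m E) (hbase : Holds s baseA (u + combination m E n))
    (hdigits : Holds s digitA (digit (fun j => E j j ≠ 0) n)) :
    WP N increment (fun s' => Holds s' baseA (u + combination m E (n + 1)) ∧
      Holds s' digitA (digit (fun j => E j j ≠ 0) (n + 1)) ∧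
      s'.mem (carryR, 0) = if n + 1 = 2 ^ rank m E then 1 else 0) s := by
  refine .seq <| .assign <| wp_forRows (Incrementing m E u n) hN (by simpa using hs) rfl rfl rfl
    (fun k s h a v ha => h.set_of_ne
      ((by decide : ∀ a ∈ [rowR, startR], a ∉ [baseA, digitA, carryR]) a ha))
    ⟨?_, ?_, ?_⟩ (fun k hk s' hF hrow hstart h => wp_incrementDigit hN
      ((hF.mem _ _ rfl).trans (by simpa using hs))
      ((hE.set_of_ne (by decide)).frame hF fun _ => rfl) hechelon hk hrow hstart h)
    fun s' _ h => ⟨?_, ?_, ?_⟩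
  · rw [Finset.sum_range_zero, add_zero]
    exact hbase.set_of_ne (by decide)
  · rw [indicator_Iio_zero, add_zero]
    exact hdigits.set_of_ne (by decide)
  · simp [rank, Expr.eval]
  · rw [combination_succ, ← add_assoc]
    exact h.base
  · have hflips : Function.support (flips (fun j => E j j ≠ 0) n) ⊆ Set.Iio m := fun j hj => by
      by_contra hm
      exact hj (if_neg fun hp => hp.1 (hechelon.apply_eq_zero_of_le (not_lt.1 hm)))
    rw [digit_succ, ← Set.indicator_eq_self.2 hflips]
    exact h.digits
  · have hdvd : 2 ^ rank m E ∣ n + 1 ↔ n + 1 = 2 ^ rank m E :=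
      ⟨fun h => le_antisymm hn (Nat.le_of_dvd n.succ_pos h), fun h => h ▸ dvd_rfl⟩
    simp only [h.carry, hdvd]

lemma wp_writeBase (hN : m ≤ N) (hs : s.mem (inputA, 0) = m)
    (hbase : Holds s baseA u) (hbuf : s.buf = []) :
    WP N writeBase (fun s' => s'.buf = bits m u ∧ s'.out = s.out) s := by
  refine WP.forLoop (fun j s' => s'.buf = bits j u ∧ s'.out = s.out) hN rfl (fun _ _ _ h => h)
    ⟨hbuf, rfl⟩ (fun s' hF => (hF.mem _ _ rfl).trans hs)
    (fun j _ s' hF hj h => .write ⟨?_, h.2⟩) fun s' _ h => h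
  simp [bits, List.range_succ, h.1, Expr.eval, hj, hbase.frame hF (fun _ => rfl) j]

lemma wp_round {s₀ : State} (hN : φ.length ≤ N) (hE : Echelon φ.length E)
    (hk : k < 2 ^ rank φ.length E) (h : Enumerated φ E s₀ k s) :
    WP N round (fun s' => Enumerated φ E s₀ (k + 1) s' ∧ s.out.length < s'.out.length) s := by
  refine WP.mono (Q := fun s' => (Holds s' baseA (φ.base + combination φ.length E (k + 1)) ∧
    Holds s' digitA (digit (fun j => E j j ≠ 0) (k + 1)) ∧
    s'.mem (carryR, 0) = if k + 1 = 2 ^ rank φ.length E then 1 else 0) ∧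
    (∀ a ∈ [entryR, rowR, startR], s'.mem (a, 0) = 0) ∧ s'.buf = [] ∧
    s'.out = s.out ++ [bits φ.length (φ.base + combination φ.length E k)]) ?_ ?_
  · refine WP.seq ((wp_writeBase hN h.input.length h.base h.buf).mono
      fun s₁ hF₁ ⟨hbuf, hout⟩ => .seq <| .emit <| .seq ?_)
    have hrows := h.rows.frame hF₁ fun _ => rfl
    have hbase := h.base.frame hF₁ fun _ => rfl
    have hdigits := h.digits.frame hF₁ fun _ => rfl
    refine (wp_increment (s := ⟨s₁.mem, [], s₁.out ++ [s₁.buf]⟩) hN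
      ((hF₁.mem _ _ rfl).trans h.input.length) hrows hE hk hbase hdigits).mono
      fun s₂ hF₂ ⟨hbase, hdigits, hcarry⟩ => wp_reset.mono fun s₃ hF₃ hscalars => ?_
    refine ⟨⟨hbase.frame hF₃ fun _ => rfl, hdigits.frame hF₃ fun _ => rfl,
      (hF₃.mem _ _ rfl).trans hcarry⟩, hscalars, (hF₃.buf rfl).trans (hF₂.buf rfl), ?_⟩
    rw [hF₃.out rfl, hF₂.out rfl, hbuf, hout]
  · rintro s' hF ⟨⟨hbase, hdigits, hcarry⟩, hscalars, hbuf, hout⟩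
    refine ⟨{
      input := h.input.frame hF fun _ => rfl
      rows := h.rows.frame hF fun _ => rfl
      base := hbase
      digits := hdigits
      carry := hcarry
      scalars := hscalars
      other := fun a i ha => (hF.mem a i ha).trans (h.other a i ha)
      buf := hbuf
      out := by rw [hout, h.out, List.range_succ, List.map_append, List.map_singleton] }, ?_⟩
    rw [hout, List.length_append, List.length_singleton]
    exact Nat.lt_succ_self _

lemma of_round_writes (h : round.writes a i = true) :
    (a = baseA ∨ a = digitA) ∨ i = 0 ∧ (a ∈ [entryR, rowR, startR] ∨ a = carryR) := by
  simp only [round, writeBase, increment, forRows, incrementDigit, addRow, reset, Prog.walk,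
    Prog.forLoop, Prog.writes, Bool.false_or, Bool.or_false, Bool.or_self, Bool.or_eq_true,
    Bool.and_eq_true, beq_iff_eq, List.mem_cons, List.not_mem_nil, or_false] at h ⊢
  tauto

lemma Holds.eq_zero_or_one (h : Holds s a u) (hu : m ≤ i → u i = 0) :
    s.mem (a, i) = 0 ∨ i < m ∧ s.mem (a, i) = 1 := by
  have hval : ∀ c : ZMod 2, c.val = 0 ∨ c ≠ 0 ∧ c.val = 1 := by decide
  rw [h i]
  exact (hval (u i)).imp_right fun ⟨h₀, h₁⟩ => ⟨not_le.1 fun hi => h₀ (hu hi), h₁⟩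

lemma Enumerated.eq_zero_or_one {s₀ : State} (hE : Echelon φ.length E)
    (h : Enumerated φ E s₀ k s) (ha : round.writes a i = true) :
    s.mem (a, i) = 0 ∨ i < φ.length + 1 ∧ s.mem (a, i) = 1 := by
  rcases of_round_writes ha with (rfl | rfl) | ⟨rfl, ha | rfl⟩
  · refine (h.base.eq_zero_or_one fun hi => ?_).imp_right (And.imp_left Nat.lt_succ_of_lt)
    simp [XorCNF.base, clausewise_of_ge hi, combination, hE.apply_eq_zero_of_le hi]
  · refine (h.digits.eq_zero_or_one fun hi => ?_).imp_right (And.imp_left Nat.lt_succ_of_lt)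
    simp [digit, hE.apply_eq_zero_of_le hi]
  · exact .inl (h.scalars a ha)
  · rw [h.carry]
    split_ifs <;> simp

lemma Enumerated.bounded {s₀ : State} {B : ℕ} (hE : Echelon φ.length E)
    (h : Enumerated φ E s₀ k s) (hB : Bounded B s₀.mem) :
    Bounded (B + (carryR + 1) * (φ.length + 1)) s.mem := by
  refine hB.of_bits fun ⟨a, i⟩ => ?_
  by_cases ha : round.writes a i = true
  · have harray : a < carryR + 1 := by
      rcases of_round_writes ha with (rfl | rfl) | ⟨-, ha | rfl⟩
      · decide
      · decide
      · exact (by decide : ∀ a ∈ [entryR, rowR, startR], a < carryR + 1) a ha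
      · decide
    exact .inr ((h.eq_zero_or_one hE ha).imp_right (And.intro harray))
  · exact .inl (h.other a i (by simpa using ha))

lemma nodup_map_range_of_bijOn {α : Type*} {f : ℕ → α} {S : Set α} (h : Set.BijOn f (Set.Iio n) S) :
    ((List.range n).map f).Nodup ∧ {x | x ∈ (List.range n).map f} = S := by
  refine ⟨(List.nodup_map_iff_inj_on List.nodup_range).2 fun i hi j hj => ?_, ?_⟩
  · exact h.injOn (List.mem_range.1 hi) (List.mem_range.1 hj)
  · rw [← h.image_eq]
    ext x
    simp

lemma enumInvariant_enumerated {s₀ : State} (hN : φ.length ≤ N) (hE : Echelon φ.length E)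
    (hspan : Submodule.span (ZMod 2) (Set.range E) =
      Submodule.span (ZMod 2) (φ.column '' {x | x ∈ φ.encode}))
    (h₀ : Enumerated φ E s₀ 0 s₀) :
    EnumInvariant N ((carryR + 1) * (N + 1)) (.sub (.lit 1) (.var carryR)) round φ.signatures s₀
      (2 ^ rank φ.length E) (Enumerated φ E s₀) where
  entry := h₀
  guard k hk s h := by
    simp only [Expr.eval, h.carry]
    split_ifs <;> omega
  round k hk s h := wp_round hN hE hk h
  bounded k s h B hB := (h.bounded hE hB).mono (by gcongr)
  final s h := by
    rw [h.out]
    exact nodup_map_range_of_bijOn (φ.bijOn_bits.comp (hspan ▸ hE.bijOn_combination))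

end XorCNF

theorem theorem1p1 :
    RAM.EnumerableWithPolyDelayPolySpace XorCNF.encode XorCNF.signatures := by
  refine RAM.enumerable_of_loop (P := XorCNF.prepare) (Q := XorCNF.round)
    (e := .sub (.lit 1) (.var XorCNF.carryR)) (.C (XorCNF.carryR + 1) * (.X + 1)) fun φ => ?_
  have hlength := RAM.length_le_inputSize φ.encode
  refine (XorCNF.wp_prepare hlength).mono fun s₀ _ ⟨E, hE, hspan, h₀⟩ =>
    ⟨2 ^ rank φ.length E, φ.Enumerated E s₀, ?_⟩
  simpa using XorCNF.enumInvariant_enumerated (φ.length_le_length_encode.trans hlength) hE hspan h₀
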